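/- **Notation.** Let $g\ge 0$ be an integer and $X$ a finite set, $n=|X|$. *Blocks.* A block in $X\times X$ is a set $B=V\times V^c$ with $\varnothing\subsetneq V\subsetneq X$; $\mathcal B[X]$ is the set of blocks. For $D\subseteq X\times X$ put $\bar D=\{(j,i):(i,j)\in D\}$, and let $\epsilon_D(i,j)=1$ if $(i,j)\in D\cup\bar D$ and $\epsilon_D(i,j)=-1$ otherwise. Unions of blocks may be empty. *The ring $R$.* Let $Y(X)$ be the set of variables $y^+_{ij}$ ($i,j\in X$) and $y^-_{ij}$ ($i\ne j\in X$), and put $y^-_{ii}=0$. Let $I\subset\mathbb Q[Y(X)]$ be the ideal generated by $$y^-_{ij}+y^-_{ji},\qquad y^+_{ij}-y^+_{ji},\qquad y^-_{ij}+y^-_{jk}+y^-_{ki},\qquad y^+_{ij}-y^+_{jk}+y^-_{ki}$$ for all $i,j,k\in X$ (not necessarily distinct); these are the linear relations satisfied by the Chern classes $c_1(L^\pm_{ij})$. Put $R=\mathbb Q[Y(X)]/I$ and write $[p]$ for the class of $p$. *Collections of sections.* For each sign $\pm$, $i,j$ in a finite set and $1\le l\le 2g$ there is a symbol $s^\pm_{ij}(x_l)$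 (standing for a section of $L^\pm_{ij}$, where $x_1,\dots,x_{2g}$ are the generators $a_1,\dots,a_g,b_1,\dots,b_g$). Write $[m]=\{1,\dots,m\}$. For $B\in\mathcal B[[m]]\cup\{\varnothing\}$ and a $2g$-tuple $D=(D_1,\dots,D_{2g})$ of unions of blocks in $\mathcal B[[m]]$ let $$Q_m(B,D)=\bigcup_{l=1}^{2g}\{s^+_{ij}(x_l),s^-_{ij}(x_l):(i,j)\in D_l\}\cup\{s^{-\epsilon_B(i,j)}_{ij}(x_l):(i,j)\notin D_l\cup\bar D_l\}.$$ The sets $\mathcal A_m$ of collections of such symbols over $[m]$ are defined recursively: (a) every $Q_m(B,D)$ as above is in $\mathcal A_m$; (b) if $[m]=U\sqcup W$ with $U,W\neq\varnothing$, $f:[|U|]\to U$ is a bijection and $P\in\mathcal A_{|U|}$, then $f_*P\cup\{s^+_{ij}(x_l),s^-_{ij}(x_l): i\in U,\ j\in W,\ 1\le l\le 2g\}\in\mathcal A_m$. Here $f_*$ sends $s^\pm_{ij}(x_l)$ to $s^\pm_{f(i)f(j)}(x_l)$. For a collection $P$ of symbols over $X$, let $\alpha(P)\in\mathbb Q[Y(X)]$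 be the product of $y^\pm_{ij}$ over all $s^\pm_{ij}(x_l)\in P$. **Proposition.** Let $p\in\mathbb Q[Y(X)]$ be a polynomial all of whose monomials have degree at least $2gn^2+\frac12(n-1)(n-2)$. Then there are an integer $r\ge0$ and - for each block $B=V\times V^c\in\mathcal B[X]$ and each $1\le k\le r$: polynomials $\theta_{B,k},\phi_{B,k}\in\mathbb Q[Y(X)]$, elements $p_{V,k}\in\mathcal A_{|V|}$ and $p_{V^c,k}\in\mathcal A_{|V^c|}$, and bijections $f_{V,k}:[|V|]\to V$ and $f_{V^c,k}:[|V^c|]\to V^c$ (all of them depending on $B$); - for each $C\in\mathcal B[X]\cup\{\varnothing\}$: a polynomial $\psi_C\in\mathbb Q[Y(X)]$, a finite set $\mathcal D_C$ of $2g$-tuples of unions of blocks in $\mathcal B[X]$, and polynomials $\chi_{C,D}\in\mathbb Q[Y(X)]$ for $D\in\mathcal D_C$, such that in $R$ $$\begin{aligned}[p]=\Bigl[&\sum_{B=V\times V^c\in\mathcal B[X]}\ \prod_{(i,j)\in B}(y^+_{ij}y^-_{ij})^{2g}\ \sum_{k=1}^{r}\bigl(\theta_{B,k}\,\alpha((f_{V,k})_*p_{V,k})+\phi_{B,k}\,\alpha((f_{V^c,k})_*p_{V^c,k})\bigr)\\&+\sum_{C\in\mathcal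 B[X]\cup\{\varnothing\}}\psi_C\sum_{D\in\mathcal D_C}\chi_{C,D}\prod_{m=1}^{2g}\Bigl(\prod_{(i,j)\in D_m}y^+_{ij}y^-_{ij}\Bigr)\Bigl(\prod_{(i,j)\notin D_m\cup\bar D_m}y^{-\epsilon_C(i,j)}_{ij}\Bigr)\Bigr].\end{aligned}$$ If $p$ is homogeneous, then all $\theta_{B,k},\phi_{B,k},\psi_C,\chi_{C,D}$ can be chosen homogeneous. -/

import Mathlib

open scoped BigOperators

namespace GoodMonomials

noncomputable section

/-! ### Blocks -/

section Blocks

variable {X : Type*} [Fintype X] [DecidableEq X]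

/-- The nonempty proper subsets `V` of `X`; these index the blocks `V × Vᶜ`. -/
def properSubsets (X : Type*) [Fintype X] [DecidableEq X] : Finset (Finset X) :=
  Finset.univ.filter fun V => V.Nonempty ∧ V ≠ Finset.univ

/-- The subset `V × Vᶜ` of `X × X`. -/
def block (V : Finset X) : Finset (X × X) := V ×ˢ Vᶜ

/-- The set of all blocks in `X × X`. -/
def blocks (X : Type*) [Fintype X] [DecidableEq X] : Finset (Finset (X × X)) :=
  (properSubsets X).image block

/-- `D` is a (possibly empty) union of blocks in `X × X`. -/
def IsUnionOfBlocks (D : Finset (X × X)) : Prop :=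
  ∃ S : Finset (Finset (X × X)), S ⊆ blocks X ∧ D = S.biUnion id

/-- The transpose of a subset of `X × X`; it sends `V × Vᶜ` to `Vᶜ × V`. -/
def bar (D : Finset (X × X)) : Finset (X × X) := D.image Prod.swap

/-- The sign `ε_B(i,j)`: it is `1` on `B ∪ bar B` and `-1` elsewhere. -/
def eps (B : Finset (X × X)) (i j : X) : ℤˣ :=
  if (i, j) ∈ B ∪ bar B then 1 else -1

end Blocks

/-! ### The polynomial ring and its quotient `R` -/

section Ring

variable {X : Type*} [DecidableEq X]

/-- The variables: `y⁺_{ij}` for all `i, j`, and `y⁻_{ij}` for `i ≠ j`. -/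
inductive YVar (X : Type*) : Type _
  | plus (i j : X) : YVar X
  | minus (i j : X) (h : i ≠ j) : YVar X

/-- The polynomial ring `ℚ[Y(X)]`. -/
abbrev YPoly (X : Type*) : Type _ := MvPolynomial (YVar X) ℚ

/-- The element `y⁺_{ij}`. -/
def yPlus (i j : X) : YPoly X := MvPolynomial.X (YVar.plus i j)

/-- The element `y⁻_{ij}`, with the convention `y⁻_{ii} = 0` (there is no variable `y⁻_{ii}`);
the convention only serves to read the defining relations for triples with repetitions. -/
def yMinus (i j : X) : YPoly X :=
  if h : i ≠ j then MvPolynomial.X (YVar.minus i j h) else 0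

/-- The element `y^s_{ij}` for a sign `s`. -/
def y (s : ℤˣ) (i j : X) : YPoly X := if s = 1 then yPlus i j else yMinus i j

/-- The ideal `I` of relations. -/
def relIdeal (X : Type*) [DecidableEq X] : Ideal (YPoly X) :=
  Ideal.span
    ({q | ∃ i j : X, q = yMinus i j + yMinus j i} ∪
     {q | ∃ i j : X, q = yPlus i j - yPlus j i} ∪
     {q | ∃ i j k : X, q = yMinus i j + yMinus j k + yMinus k i} ∪
     {q | ∃ i j k : X, q = yPlus i j - yPlus j k + yMinus k i})

/-- The quotient ring `R = ℚ[Y(X)] / I`. -/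
abbrev R (X : Type*) [DecidableEq X] : Type _ := YPoly X ⧸ relIdeal X

/-- The class `[p]` in `R` of a polynomial `p`. -/
def cls (p : YPoly X) : R X := Ideal.Quotient.mk (relIdeal X) p

/-- `p` is homogeneous of some degree. -/
def Homogeneous (p : YPoly X) : Prop := ∃ k : ℕ, p.IsHomogeneous k

end Ring

/-! ### Collections of sections -/

section Sections

/-- The index set of the sections `s^±_{ij}(x_l)`: the tuple `(s, i, j, l)` stands for the section
`s^s_{ij}(x_l)` of `L^s_{ij}`, where `x_1, …, x_{2g}` is the list
`a_1, …, a_g, b_1, …, b_g` of generators. -/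
abbrev Sec (X : Type*) (g : ℕ) : Type _ := ℤˣ × X × X × Fin (2 * g)

variable {X : Type*} [DecidableEq X] {g : ℕ}

/-- The map `α` on a collection of sections: the product of the `y^±_{ij}`
over all `s^±_{ij}(x)` in the collection. -/
def alpha (P : Finset (Sec X g)) : YPoly X := ∏ σ ∈ P, y σ.1 σ.2.1 σ.2.2.1

/-- The induced map `ψ_*`, sending `s^±_{ij}(x)` to `s^±_{ψ(i)ψ(j)}(x)`. -/
def push {Z : Type*} (ψ : Z → X) (P : Finset (Sec Z g)) : Finset (Sec X g) :=
  P.image fun σ => (σ.1, ψ σ.2.1, ψ σ.2.2.1, σ.2.2.2)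

variable [Fintype X]

/-- The collection `Q(X, B, D)`: for every `l`, both sections `s^±_{ij}(x_l)` for `(i,j) ∈ D_l`,
and `s^{-ε_B(i,j)}_{ij}(x_l)` for `(i,j) ∉ D_l ∪ bar D_l`. -/
def Q (B : Finset (X × X)) (D : Fin (2 * g) → Finset (X × X)) : Finset (Sec X g) :=
  Finset.univ.filter fun σ =>
    (σ.2.1, σ.2.2.1) ∈ D σ.2.2.2 ∨
      ((σ.2.1, σ.2.2.1) ∉ D σ.2.2.2 ∪ bar (D σ.2.2.2) ∧ σ.1 = -eps B σ.2.1 σ.2.2.1)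

/-- All sections `s^+_{ij}(x), s^-_{ij}(x)` with `i ∈ U` and `j ∉ U`. -/
def crossing (U : Finset X) : Finset (Sec X g) :=
  Finset.univ.filter fun σ => σ.2.1 ∈ U ∧ σ.2.2.1 ∉ U

/-- The recursively defined sets `𝒜_n` of collections of sections; `A g n P` says `P ∈ 𝒜_n`.
Here `Fin n` plays the role of `{1, …, n}`, and `{1, …, n} = U ⊔ Uᶜ` is the partition
in the second clause. -/
inductive A (g : ℕ) : (n : ℕ) → Finset (Sec (Fin n) g) → Prop
  | base {n : ℕ} (B : Finset (Fin n × Fin n)) (hB : B ∈ insert ∅ (blocks (Fin n)))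
      (D : Fin (2 * g) → Finset (Fin n × Fin n)) (hD : ∀ l, IsUnionOfBlocks (D l)) :
      A g n (Q B D)
  | extend {n : ℕ} (U : Finset (Fin n)) (hU : U ∈ properSubsets (Fin n))
      (ψ : Fin U.card ≃ {i // i ∈ U}) (P : Finset (Sec (Fin U.card) g)) (hP : A g U.card P) :
      A g n (push (fun i => (ψ i : Fin n)) P ∪ crossing U)

end Sections

end

end GoodMonomials

open GoodMonomials

namespace GoodMonomials


/-! ### Linear forms `a i`, `a i ± a j` and their monomials -/

section Forms

/-! In `R` put `a i = y⁺_{ii} / 2`; then `y^±_{ij} = a i ± a j`. With `h = 2g`, the theorem becomes: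
the power `powerBound h n` of the ideal generated by the `a i` lies in the ideal `J` generated by
the products attached to cuts and to pairs (`B`, `D`). Collections on proper subsets are handled by
strong induction on `n` (`pow_le_span_sectionProduct`); the core is `formMonomial_mem`.

That lemma treats monomials in the `n²` forms `a i`, `a i ± a j`, by induction towards larger
`totalWeight`. A factor that is a rational combination of forms with exponents below `h` and smaller
by at least two may be exchanged for these, which raises the weight. Suppose a monomial `m` of large
degree is not in `J` while all heavier ones are.

No cut has all its crossing forms with exponent at least `h`: otherwise the cut product divides `m`,
and the rest has enough degree to be split between the two sides (`formMonomial_mem_of_cut`). Hence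
the pairs carrying a form of exponent below `h` connect `X`. By `exists_signs` there are signs `ε`
for which the major forms `a i`, `a i + ε i ε j a j` have exponent at least `h`; only the minor
forms `a i - ε i ε j a j` can have small exponents `q`.

View `q` as edge weights of the complete graph, and let `bottleneck q p` be the first level at which
the ends of `p` are joined. Always `bottleneck - 1 ≤ q`, and exchange gives `q ≤ bottleneck`. The
pairs attaining the lower bound connect `X`, so there are at least `n - 1` of them and `∑ q` exceeds
`∑ (bottleneck - 1)` by at most `(n - 1)(n - 2) / 2`. This is the source of that term in the bound.

The components of the level graphs, with `ε`, define a good monomial `T` in `J` whose minor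
exponents are `bottleneck - 1`. The degree bound leaves `m` at least as many major factors as `T`.
Modulo heavier monomials all major forms are proportional, so they can be exchanged until `T`
divides the monomial (`formMonomial_mem_of_major`), a contradiction. -/

/-- The unordered pairs of distinct elements of `X`, listed increasingly with respect to `o`. -/
abbrev Pairs {X : Type*} (o : X → ℕ) : Type _ := {p : X × X // o p.1 < o p.2}

/-- The index set of the linear forms `a i` and `a i ± a j`. -/
abbrev FormIndex {X : Type*} (o : X → ℕ) : Type _ := X ⊕ (Pairs o × ℤˣ)

lemma exists_eq_add_single {X : Type*} {o : X → ℕ} [DecidableEq (FormIndex o)]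
    {m : FormIndex o → ℕ}
    {x : FormIndex o} (h : 0 < m x) : ∃ m' : FormIndex o → ℕ, m = m' + Pi.single x 1 ∧ m' x + 1 = m x ∧
      ∀ k ≠ x, m' k = m k := by
  refine ⟨m - Pi.single x 1, ?_, ?_, ?_⟩
  · ext k
    by_cases hk : k = x
    · subst hk; simp; omega
    · simp [hk]
  · simp; omega
  · intro k hk; simp [hk]

variable {X : Type*} [Fintype X] {A : Type*} [CommRing A]

/-- The linear forms `a i` and `a i + s a j`. -/
def form (o : X → ℕ) (a : X → A) : FormIndex o → A
  | Sum.inl i => a i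
  | Sum.inr (p, s) => a p.1.1 + ((s : ℤ) : A) * a p.1.2

/-- The monomial in the linear forms with the given exponents. -/
noncomputable def formMonomial (o : X → ℕ) (a : X → A) (m : FormIndex o → ℕ) : A :=
  ∏ k, form o a k ^ m k

lemma prod_units_int {M : Type*} [CommMonoid M] (f : ℤˣ → M) (s : ℤˣ) :
    ∏ t, f t = f s * f (-s) := by
  rcases Int.units_eq_one_or s with rfl | rfl <;>
    simp [UnitsInt.univ, mul_comm]

lemma sum_units_int {M : Type*} [AddCommMonoid M] (f : ℤˣ → M) (s : ℤˣ) :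
    ∑ t, f t = f s + f (-s) := by
  rcases Int.units_eq_one_or s with rfl | rfl <;>
    simp [UnitsInt.univ, add_comm]

lemma prod_prod_eq_diag_mul_pairs {M : Type*} [CommMonoid M] {o : X → ℕ}
    (ho : Function.Injective o) (w : X → X → M) :
    ∏ i, ∏ j, w i j = (∏ i, w i i) * ∏ p : Pairs o, w p.1.1 p.1.2 * w p.1.2 p.1.1 := by
  classical
  have h1 : ∀ f : X × X → M, ∏ p : Pairs o, f p.1
      = ∏ p ∈ (Finset.univ : Finset (X × X)).filter (fun p => o p.1 < o p.2), f p := by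
    intro f
    rw [Finset.prod_subtype (p := fun p : X × X => o p.1 < o p.2)]
    simp
  have h2 : ∏ p ∈ (Finset.univ : Finset (X × X)).filter (fun p => o p.1 < o p.2), w p.2 p.1
      = ∏ p ∈ (Finset.univ : Finset (X × X)).filter (fun p => o p.2 < o p.1), w p.1 p.2 := by
    refine Finset.prod_nbij' Prod.swap Prod.swap ?_ ?_ ?_ ?_ ?_ <;> simp
  have h3 : ∏ p ∈ (Finset.univ : Finset (X × X)).filter (fun p => p.1 = p.2), w p.1 p.2
      = ∏ i, w i i := by
    refine Finset.prod_nbij' Prod.fst (fun i => (i, i)) ?_ ?_ ?_ ?_ ?_ <;> simp +contextual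
  rw [Finset.prod_mul_distrib, h1 (fun p => w p.1 p.2), h1 (fun p => w p.2 p.1), h2, ← h3,
    ← Fintype.prod_prod_type' (f := w), Finset.prod_filter, Finset.prod_filter,
    Finset.prod_filter, ← Finset.prod_mul_distrib, ← Finset.prod_mul_distrib]
  refine Finset.prod_congr rfl fun p _ => ?_
  rcases lt_trichotomy (o p.1) (o p.2) with h | h | h
  · have : p.1 ≠ p.2 := fun e => by simp [e] at h
    simp [h, this, h.not_gt]
  · simp [ho h]
  · have : p.1 ≠ p.2 := fun e => by simp [e] at h
    simp [h, this, h.not_gt]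

lemma card_add_two_mul_card_pairs {o : X → ℕ} (ho : Function.Injective o) :
    Fintype.card X + 2 * Fintype.card (Pairs o) = Fintype.card X ^ 2 := by
  have := prod_prod_eq_diag_mul_pairs (M := Multiplicative ℕ) ho
    (fun _ _ => Multiplicative.ofAdd 1)
  apply_fun Multiplicative.toAdd at this
  simp at this
  nlinarith

lemma prod_formIndex {M : Type*} [CommMonoid M] {o : X → ℕ} (ε : X → ℤˣ) (f : FormIndex o → M) :
    ∏ k, f k = (∏ i, f (Sum.inl i)) *
      ∏ p : Pairs o, f (Sum.inr (p, ε p.1.1 * ε p.1.2)) * f (Sum.inr (p, -(ε p.1.1 * ε p.1.2))) := by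
  rw [Fintype.prod_sum_type, Fintype.prod_prod_type]
  congr 1
  exact Finset.prod_congr rfl fun p _ => prod_units_int (fun s => f (Sum.inr (p, s))) _

lemma sum_formIndex {o : X → ℕ} (ε : X → ℤˣ) (f : FormIndex o → ℕ) :
    ∑ k, f k = (∑ i, f (Sum.inl i)) +
      ∑ p : Pairs o, (f (Sum.inr (p, ε p.1.1 * ε p.1.2)) +
        f (Sum.inr (p, -(ε p.1.1 * ε p.1.2)))) := by
  rw [Fintype.sum_sum_type, Fintype.sum_prod_type]
  congr 1
  exact Finset.sum_congr rfl fun p _ => sum_units_int (fun s => f (Sum.inr (p, s))) _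

lemma card_formIndex {o : X → ℕ} (ho : Function.Injective o) :
    Fintype.card (FormIndex o) = Fintype.card X ^ 2 := by
  rw [← card_add_two_mul_card_pairs ho]
  simp [mul_comm]

variable {o : X → ℕ} {a : X → A}

lemma formMonomial_add (m m' : FormIndex o → ℕ) :
    formMonomial o a (m + m') = formMonomial o a m * formMonomial o a m' := by
  simp [formMonomial, pow_add, Finset.prod_mul_distrib]

lemma formMonomial_single [DecidableEq (FormIndex o)] (k : FormIndex o) :
    formMonomial o a (Pi.single k 1) = form o a k := by
  rw [formMonomial, Finset.prod_eq_single k] <;> simp +contextual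

lemma formMonomial_dvd {m m' : FormIndex o → ℕ} (h : m ≤ m') :
    formMonomial o a m ∣ formMonomial o a m' :=
  Finset.prod_dvd_prod_of_dvd _ _ fun k _ => pow_dvd_pow _ (h k)

lemma sum_add_single [DecidableEq (FormIndex o)] (m : FormIndex o → ℕ) (x : FormIndex o) :
    ∑ k, (m + Pi.single x 1 : FormIndex o → ℕ) k = ∑ k, m k + 1 := by
  simp only [Pi.add_apply, Finset.sum_add_distrib, Finset.sum_pi_single', Finset.mem_univ, if_true]

/-- If one factor of a monomial is a linear combination of other forms, then the monomial is a
linear combination of the monomials obtained by exchanging this factor. -/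
lemma formMonomial_exchange [Algebra ℚ A] [DecidableEq (FormIndex o)] {J : Ideal A}
    {m : FormIndex o → ℕ} {x : FormIndex o} {S : Set (FormIndex o)}
    (hx : form o a x ∈ Submodule.span ℚ (form o a '' S))
    (hS : ∀ k ∈ S, formMonomial o a (m + Pi.single k 1) ∈ J) :
    formMonomial o a (m + Pi.single x 1) ∈ J := by
  simp only [formMonomial_add, formMonomial_single] at hS ⊢
  generalize form o a x = z at hx ⊢
  induction hx using Submodule.span_induction with
  | mem y hy => obtain ⟨k, hk, rfl⟩ := hy; exact hS k hk
  | zero => simp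
  | add y z _ _ hy hz => rw [mul_add]; exact J.add_mem hy hz
  | smul c y _ hy =>
    rw [mul_smul_comm, Algebra.smul_def]
    exact J.mul_mem_left _ hy

/-- A concave function of an exponent that is strictly increasing up to `h` and then constant. -/
def weight (h k : ℕ) : ℕ := ∑ t ∈ Finset.range k, (h - t)

/-- The total weight of a tuple of exponents. -/
noncomputable def totalWeight (h : ℕ) (m : FormIndex o → ℕ) : ℕ := ∑ k, weight h (m k)

lemma weight_succ (h k : ℕ) : weight h (k + 1) = weight h k + (h - k) :=
  Finset.sum_range_succ _ _

/-- The uniform bound is what makes induction towards larger weight terminate. -/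
lemma weight_le (h k : ℕ) : weight h k ≤ h * h := by
  have : ∀ k, weight h k + (h - k) * (h - k) ≤ h * h := by
    intro k
    induction k with
    | zero => simp [weight]
    | succ k ih =>
      rw [weight_succ]
      rcases le_or_gt h k with hk | hk
      · have h1 : h - k = 0 := by omega
        have h2 : h - (k + 1) = 0 := by omega
        simp only [h1, h2] at ih ⊢
        omega
      · obtain ⟨d, hd⟩ : ∃ d, h - k = d + 1 := ⟨h - k - 1, by omega⟩
        have h2 : h - (k + 1) = d := by omega
        rw [hd] at ih
        rw [hd, h2]
        nlinarith
  exact le_trans (Nat.le_add_right _ _) (this k)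

lemma totalWeight_le (h : ℕ) (m : FormIndex o → ℕ) :
    totalWeight h m ≤ Fintype.card (FormIndex o) * (h * h) := by
  refine (Finset.sum_le_card_nsmul _ _ (h * h) fun k _ => weight_le h (m k)).trans ?_
  simp

/-- The subtraction is truncated: factors beyond the exponent `h` carry no weight, so removing one
costs nothing. -/
lemma totalWeight_add_single [DecidableEq (FormIndex o)] (h : ℕ) (m : FormIndex o → ℕ)
    (x : FormIndex o) : totalWeight h (m + Pi.single x 1) = totalWeight h m + (h - m x) := by
  unfold totalWeight
  rw [← Finset.add_sum_erase _ _ (Finset.mem_univ x),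
    ← Finset.add_sum_erase _ (fun k => weight h (m k)) (Finset.mem_univ x)]
  have : ∑ k ∈ Finset.univ.erase x, weight h ((m + Pi.single x 1 : FormIndex o → ℕ) k)
      = ∑ k ∈ Finset.univ.erase x, weight h (m k) := by
    refine Finset.sum_congr rfl fun k hk => ?_
    simp [Finset.ne_of_mem_erase hk]
  rw [this]
  simp [weight_succ]
  omega

end Forms


/-! ### A criterion for an ideal to contain a power of the ideal generated by the `a i` -/

section Criterion

/-- The exponent `h n² + (n - 1)(n - 2) / 2`. -/
def powerBound (h n : ℕ) : ℕ := h * n ^ 2 + (n - 1).choose 2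

lemma two_mul_choose_two (n : ℕ) : 2 * n.choose 2 + n = n ^ 2 := by
  induction n with
  | zero => rfl
  | succ n ih =>
    rw [Nat.choose_succ_succ' n 1, Nat.choose_one_right]
    nlinarith

/-- Degree count for a cut into parts of sizes `u` and `v`: the cut product has degree `2huv`, and
what remains suffices for both parts together. -/
lemma powerBound_add_le (h : ℕ) {u v : ℕ} (hu : 0 < u) (hv : 0 < v) :
    powerBound h u + powerBound h v + 2 * h * (u * v) ≤ powerBound h (u + v) := by
  obtain ⟨u, rfl⟩ := Nat.exists_eq_add_of_lt hu
  obtain ⟨v, rfl⟩ := Nat.exists_eq_add_of_lt hv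
  simp only [powerBound, zero_add, Nat.add_sub_cancel]
  have e : u + 1 + (v + 1) - 1 = u + v + 1 := by omega
  rw [e]
  have h1 := two_mul_choose_two u
  have h2 := two_mul_choose_two v
  have h3 := two_mul_choose_two (u + v + 1)
  nlinarith

variable {X : Type*} [Fintype X] [DecidableEq X] {A : Type*} [CommRing A]

/-- The product of the `((a i + a j) (a i - a j)) ^ h` over the block `V × Vᶜ`. -/
def cutProduct (a : X → A) (h : ℕ) (V : Finset X) : A :=
  ∏ i ∈ V, ∏ j ∈ Vᶜ, ((a i + a j) * (a i - a j)) ^ h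

/-- The factor at `(i, j)` of the monomial given by signs `ε` and levels `c`. -/
def levelFactor (a : X → A) (ε : X → ℤˣ) (c : X → ℕ) (i j : X) : A :=
  if c i < c j then (a i + a j) * (a i - a j)
  else if c i = c j then a i + (((ε i * ε j : ℤˣ) : ℤ) : A) * a j else 1

/-- Ideals that contain the monomials attached to cuts and those attached to signs and levels. -/
structure ContainsGoodMonomials (a : X → A) (h : ℕ) (J : Ideal A) : Prop where
  cut : ∀ V : Finset X, V.Nonempty → V ≠ Finset.univ →
    ∀ x ∈ Ideal.span (a '' (V : Set X)) ^ powerBound h V.card, cutProduct a h V * x ∈ J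
  level : ∀ (ε : X → ℤˣ) (c : Fin h → X → ℕ),
    ∏ l, ∏ i, ∏ j, levelFactor a ε (c l) i j ∈ J

lemma prod_cut_eq_prod_pairs {M : Type*} [CommMonoid M] {o : X → ℕ} (ho : Function.Injective o)
    (V : Finset X) (w : X → X → M) :
    ∏ i ∈ V, ∏ j ∈ Vᶜ, w i j = ∏ p : Pairs o, if p.1.1 ∈ V ↔ p.1.2 ∈ V then 1 else
      if p.1.1 ∈ V then w p.1.1 p.1.2 else w p.1.2 p.1.1 := by
  have h1 : ∏ i ∈ V, ∏ j ∈ Vᶜ, w i j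
      = ∏ i, ∏ j, if i ∈ V ∧ j ∉ V then w i j else 1 := by
    have : ∀ i, ∏ j, (if i ∈ V ∧ j ∉ V then w i j else 1)
        = if i ∈ V then ∏ j ∈ Vᶜ, w i j else 1 := by
      intro i
      by_cases hi : i ∈ V
      · simp only [hi, true_and, if_true]
        rw [← Finset.prod_filter]
        exact Finset.prod_congr (by ext; simp) fun _ _ => rfl
      · simp [hi]
    simp only [this, Finset.prod_ite_mem, Finset.univ_inter]
  rw [h1, prod_prod_eq_diag_mul_pairs ho]
  simp only [and_not_self, if_false, Finset.prod_const_one, one_mul]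
  refine Finset.prod_congr rfl fun p _ => ?_
  by_cases hp : p.1.1 ∈ V <;> by_cases hq : p.1.2 ∈ V <;> simp [hp, hq]

variable {o : X → ℕ} {a : X → A}

omit [Fintype X] [DecidableEq X] in
lemma associated_form_mul_form (p : Pairs o) {i j : X}
    (h : (i = p.1.1 ∧ j = p.1.2) ∨ (i = p.1.2 ∧ j = p.1.1)) (s : ℤˣ) :
    Associated ((a i + a j) * (a i - a j))
      (form o a (Sum.inr (p, s)) * form o a (Sum.inr (p, -s))) := by
  have : form o a (Sum.inr (p, s)) * form o a (Sum.inr (p, -s))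
      = (a p.1.1 + a p.1.2) * (a p.1.1 - a p.1.2) := by
    rcases Int.units_eq_one_or s with rfl | rfl <;> simp [form] <;> ring
  rw [this]
  rcases h with ⟨rfl, rfl⟩ | ⟨rfl, rfl⟩
  · rfl
  · exact ⟨-1, by simp; ring⟩

lemma associated_cutProduct (ho : Function.Injective o) (h : ℕ) (V : Finset X)
    (c : FormIndex o → ℕ) (hc : ∀ i, c (Sum.inl i) = 0)
    (hc' : ∀ p s, c (Sum.inr (p, s)) = if p.1.1 ∈ V ↔ p.1.2 ∈ V then 0 else h) :
    Associated (cutProduct a h V) (formMonomial o a c) := by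
  rw [cutProduct, prod_cut_eq_prod_pairs ho, formMonomial, prod_formIndex (fun _ => 1)]
  simp only [hc, hc', pow_zero, Finset.prod_const_one, one_mul, mul_one]
  refine Associated.prod _ _ _ fun p _ => ?_
  split_ifs with h1 h2
  · simp
  · rw [← mul_pow]
    exact (associated_form_mul_form p (Or.inl ⟨rfl, rfl⟩) 1).pow_pow
  · rw [← mul_pow]
    exact (associated_form_mul_form p (Or.inr ⟨rfl, rfl⟩) 1).pow_pow

omit [DecidableEq X] in
lemma formMonomial_mem_pow (m : FormIndex o → ℕ) :
    formMonomial o a m ∈ Ideal.span (Set.range a) ^ ∑ k, m k := by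
  rw [← Finset.prod_pow_eq_pow_sum]
  refine Ideal.prod_mem_prod fun k _ => Ideal.pow_mem_pow ?_ _
  have : ∀ i, a i ∈ Ideal.span (Set.range a) := fun i => Ideal.subset_span ⟨i, rfl⟩
  rcases k with i | ⟨p, s⟩
  · exact this i
  · exact Ideal.add_mem _ (this _) (Ideal.mul_mem_left _ _ (this _))

/-- The cut product divides the monomial. Its cofactor is a sum of two terms, each of high order in
the variables of one side, and the cut products of `V` and `Vᶜ` agree up to a unit. -/
lemma formMonomial_mem_of_cut {h : ℕ} {J : Ideal A} (hJ : ContainsGoodMonomials a h J)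
    (ho : Function.Injective o) {m : FormIndex o → ℕ}
    (hm : powerBound h (Fintype.card X) ≤ ∑ k, m k) {V : Finset X} (hV : V.Nonempty)
    (hV' : V ≠ Finset.univ)
    (hc : ∀ p : Pairs o, ¬(p.1.1 ∈ V ↔ p.1.2 ∈ V) → ∀ s, h ≤ m (Sum.inr (p, s))) :
    formMonomial o a m ∈ J := by
  let c : FormIndex o → ℕ := Sum.elim (fun _ => 0)
    fun x => if x.1.1.1 ∈ V ↔ x.1.1.2 ∈ V then 0 else h
  have hcm : c ≤ m := by
    rintro (i | ⟨p, s⟩)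
    · simp [c]
    · by_cases hp : p.1.1 ∈ V ↔ p.1.2 ∈ V
      · simp [c, hp]
      · simpa [c, hp] using hc p hp s
  have hVc : Vᶜ.Nonempty := by
    rwa [Finset.nonempty_iff_ne_empty, Ne, Finset.compl_eq_empty_iff]
  have hVc' : Vᶜ ≠ Finset.univ := by
    rwa [Ne, Finset.compl_eq_univ_iff, ← Ne, ← Finset.nonempty_iff_ne_empty]
  have h1 : Associated (cutProduct a h V) (formMonomial o a c) :=
    associated_cutProduct ho h V c (fun _ => rfl) fun _ _ => rfl
  have h2 : Associated (cutProduct a h Vᶜ) (formMonomial o a c) :=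
    associated_cutProduct ho h Vᶜ c (fun _ => rfl) fun p s => by
      simp only [c, Sum.elim_inr, Finset.mem_compl, not_iff_not]
  have hsum : ∑ k, c k = 2 * h * (V.card * Vᶜ.card) := by
    have := prod_cut_eq_prod_pairs (M := Multiplicative ℕ) ho V
      (fun _ _ => Multiplicative.ofAdd h)
    apply_fun Multiplicative.toAdd at this
    simp only [Finset.prod_const, toAdd_pow, toAdd_ofAdd, toAdd_prod, ite_self, apply_ite,
      toAdd_one, smul_eq_mul] at this
    rw [sum_formIndex (fun _ => 1)]
    simp only [c, Sum.elim_inl, Sum.elim_inr, Finset.sum_const_zero, zero_add, ← two_mul,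
      ← Finset.mul_sum, ← this]
    ring
  have hcard : V.card + Vᶜ.card = Fintype.card X := Finset.card_add_card_compl V
  have hdeg : powerBound h V.card + powerBound h Vᶜ.card ≤ ∑ k, (m - c) k := by
    have hb := powerBound_add_le h hV.card_pos hVc.card_pos
    have : ∑ k, (m - c) k + ∑ k, c k = ∑ k, m k := by
      rw [← Finset.sum_add_distrib]
      exact Finset.sum_congr rfl fun k _ => Nat.sub_add_cancel (hcm k)
    rw [hcard] at hb
    omega
  have hsplit : Ideal.span (Set.range a)
      = Ideal.span (a '' (V : Set X)) ⊔ Ideal.span (a '' ((Vᶜ : Finset X) : Set X)) := by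
    rw [← Ideal.span_union, ← Set.image_union, Finset.coe_compl, Set.union_compl_self,
      Set.image_univ]
  -- Pigeonhole for ideals: `(I + K) ^ (s + t) ≤ I ^ s + K ^ t`.
  have hmem : formMonomial o a (m - c) ∈ Ideal.span (a '' (V : Set X)) ^ powerBound h V.card ⊔
      Ideal.span (a '' ((Vᶜ : Finset X) : Set X)) ^ powerBound h Vᶜ.card := by
    refine Ideal.sup_pow_add_le_pow_sup_pow ?_
    rw [← hsplit]
    exact Ideal.pow_le_pow_right hdeg (formMonomial_mem_pow _)
  obtain ⟨x, hx, z, hz, hxz⟩ := Submodule.mem_sup.1 hmem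
  have hprod : formMonomial o a m = formMonomial o a c * x + formMonomial o a c * z := by
    rw [← mul_add, hxz, ← formMonomial_add, add_tsub_cancel_of_le hcm]
  rw [hprod]
  refine J.add_mem ?_ ?_
  · obtain ⟨e, he⟩ := h1
    rw [← he, mul_right_comm]
    exact J.mul_mem_right _ (hJ.cut V hV hV' x hx)
  · obtain ⟨e, he⟩ := h2
    rw [← he, mul_right_comm]
    exact J.mul_mem_right _ (hJ.cut Vᶜ hVc hVc' z hz)

end Criterion


/-! ### Bottleneck levels of a weighted complete graph -/

section Bottleneck

variable {X : Type*} {o : X → ℕ}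

/-- The graph whose edges are the pairs satisfying `P`. -/
def pairGraph (o : X → ℕ) (P : Pairs o → Prop) : SimpleGraph X :=
  SimpleGraph.fromEdgeSet {e | ∃ p, P p ∧ s(p.1.1, p.1.2) = e}

lemma pairs_ne (p : Pairs o) : p.1.1 ≠ p.1.2 := fun h => by
  have := p.2
  simp [h] at this

lemma pairGraph_reachable {P : Pairs o → Prop} {p : Pairs o} (hp : P p) :
    (pairGraph o P).Reachable p.1.1 p.1.2 :=
  SimpleGraph.Adj.reachable ((SimpleGraph.fromEdgeSet_adj _).2 ⟨⟨p, hp, rfl⟩, pairs_ne p⟩)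

lemma pairGraph_mono {P P' : Pairs o → Prop} (h : ∀ p, P p → P' p) :
    pairGraph o P ≤ pairGraph o P' :=
  SimpleGraph.fromEdgeSet_mono fun _ ⟨p, hp, he⟩ => ⟨p, h p hp, he⟩

lemma rel_of_pairGraph_reachable {P : Pairs o → Prop} {r : X → X → Prop} (hr : Equivalence r)
    (h : ∀ p, P p → r p.1.1 p.1.2) {i j : X} (hij : (pairGraph o P).Reachable i j) : r i j := by
  obtain ⟨w⟩ := hij
  induction w with
  | nil => exact hr.refl _
  | cons hadj _ ih =>
    refine hr.trans ?_ ih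
    obtain ⟨⟨p, hp, he⟩, -⟩ := (SimpleGraph.fromEdgeSet_adj _).1 hadj
    rcases Sym2.eq_iff.1 he with ⟨h1, h2⟩ | ⟨h1, h2⟩
    · rw [← h1, ← h2]; exact h p hp
    · rw [← h1, ← h2]; exact hr.symm (h p hp)

/-- The graph of the pairs of weight less than `l`. -/
abbrev levelGraph (q : Pairs o → ℕ) (l : ℕ) : SimpleGraph X := pairGraph o fun p => q p < l

/-- The least `l` such that the elements of the pair `p` are joined by pairs of weight less
than `l`. -/
noncomputable def bottleneck (q : Pairs o → ℕ) (p : Pairs o) : ℕ :=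
  sInf {l | (levelGraph q l).Reachable p.1.1 p.1.2}

lemma levelGraph_reachable_iff (q : Pairs o → ℕ) (p : Pairs o) (l : ℕ) :
    (levelGraph q l).Reachable p.1.1 p.1.2 ↔ bottleneck q p ≤ l := by
  refine ⟨fun h => Nat.sInf_le h, fun h => ?_⟩
  have hne : {l | (levelGraph q l).Reachable p.1.1 p.1.2}.Nonempty :=
    ⟨q p + 1, pairGraph_reachable (Nat.lt_succ_self _)⟩
  exact (Nat.sInf_mem hne).mono (pairGraph_mono fun p hp => lt_of_lt_of_le hp h)

lemma bottleneck_le (q : Pairs o → ℕ) (p : Pairs o) : bottleneck q p ≤ q p + 1 :=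
  (levelGraph_reachable_iff q p _).1 (pairGraph_reachable (Nat.lt_succ_self _))

lemma bottleneck_pos (q : Pairs o → ℕ) (p : Pairs o) : 0 < bottleneck q p := by
  by_contra h
  have := (levelGraph_reachable_iff q p 0).2 (by omega)
  exact pairs_ne p (rel_of_pairGraph_reachable (r := Eq) eq_equivalence
    (fun p hp => absurd hp (Nat.not_lt_zero _)) this)

variable [Fintype X]

/-- The pairs whose weight is minimal given their bottleneck level connect the graph. -/
lemma card_le_card_tight_pairs [Nonempty X] {q : Pairs o → ℕ} {h : ℕ}
    (hconn : (levelGraph q h).Preconnected) :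
    Fintype.card X ≤ (Finset.univ.filter fun p => q p + 1 = bottleneck q p).card + 1 := by
  classical
  let H := pairGraph o fun p => q p + 1 = bottleneck q p
  -- A pair that is not tight has `bottleneck q p ≤ q p`, so its ends are joined by pairs of
  -- strictly smaller weight; induct on the weight.
  have key : ∀ v p, q p = v → H.Reachable p.1.1 p.1.2 := by
    intro v
    induction v using Nat.strong_induction_on with
    | _ v ih =>
      intro p hp
      by_cases ht : q p + 1 = bottleneck q p
      · exact pairGraph_reachable ht
      · have hle := bottleneck_le q p
        have h1 : bottleneck q p ≤ q p := by omega
        exact rel_of_pairGraph_reachable (SimpleGraph.reachable_is_equivalence _)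
          (fun p' hp' => ih (q p') (hp ▸ hp') p' rfl) ((levelGraph_reachable_iff q p _).2 h1)
  have hH : H.Connected := ⟨fun i j => rel_of_pairGraph_reachable
    (SimpleGraph.reachable_is_equivalence _) (fun p _ => key _ p rfl) (hconn i j)⟩
  have h1 := hH.card_vert_le_card_edgeSet_add_one
  have h2 : H.edgeSet ⊆ ((Finset.univ.filter fun p => q p + 1 = bottleneck q p).image
      fun p => s(p.1.1, p.1.2) : Finset (Sym2 X)) := by
    intro e he
    obtain ⟨⟨p, hp, rfl⟩, -⟩ := (SimpleGraph.edgeSet_fromEdgeSet _ ▸ he :)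
    simp only [Finset.coe_image, Set.mem_image]
    exact ⟨p, by simpa using hp, rfl⟩
  have h3 := Set.ncard_le_ncard h2 (Finset.finite_toSet _)
  rw [Set.ncard_coe_finset] at h3
  rw [Nat.card_eq_fintype_card] at h1
  have h4 := h3.trans Finset.card_image_le
  have h5 : Nat.card H.edgeSet = H.edgeSet.ncard := rfl
  omega

/-- Each `q p` is `bottleneck q p` or one less, and the latter happens for at least `n - 1` of the
`n(n - 1) / 2` pairs; at most `(n - 1)(n - 2) / 2` pairs remain. -/
lemma sum_le_sum_bottleneck (ho : Function.Injective o) {q : Pairs o → ℕ} {h : ℕ}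
    (hconn : (levelGraph q h).Preconnected) (hq : ∀ p, q p ≤ bottleneck q p) :
    ∑ p, q p ≤ ∑ p, (bottleneck q p - 1) + (Fintype.card X - 1).choose 2 := by
  classical
  rcases isEmpty_or_nonempty X with hX | hX
  · have : IsEmpty (Pairs o) := ⟨fun p => hX.elim p.1.1⟩
    simp
  have h1 := card_le_card_tight_pairs hconn
  have h2 : ∑ p, q p + (Finset.univ.filter fun p => q p + 1 = bottleneck q p).card
      ≤ ∑ p, (bottleneck q p - 1) + Fintype.card (Pairs o) := by
    rw [Finset.card_filter, ← Finset.sum_add_distrib, Fintype.card, Finset.card_eq_sum_ones,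
      ← Finset.sum_add_distrib]
    refine Finset.sum_le_sum fun p _ => ?_
    have := hq p
    have := bottleneck_le q p
    have := bottleneck_pos q p
    split_ifs <;> omega
  have h3 := card_add_two_mul_card_pairs ho
  obtain ⟨n, hn⟩ := Nat.exists_eq_succ_of_ne_zero (Fintype.card_ne_zero (α := X))
  have h4 := two_mul_choose_two n
  rw [hn] at h1 h3 ⊢
  simp only [Nat.succ_eq_add_one, Nat.add_sub_cancel] at *
  nlinarith

/-- Any numbering of the classes works: the order between different levels plays no role later. -/
lemma exists_level_function (r : X → X → Prop) (hr : Equivalence r) :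
    ∃ c : X → ℕ, ∀ i j, c i = c j ↔ r i j := by
  classical
  let S : Setoid X := ⟨r, hr⟩
  refine ⟨fun i => Fintype.equivFin (Quotient S) (Quotient.mk S i), fun i j => ?_⟩
  rw [Fin.val_inj, EmbeddingLike.apply_eq_iff_eq, Quotient.eq]
  rfl

end Bottleneck

/-! ### Rewriting monomials -/

section Rewriting

variable {X : Type*} [Fintype X] [DecidableEq X] {A : Type*} [CommRing A] [Algebra ℚ A]
  {o : X → ℕ} {a : X → A} {h N : ℕ} {J : Ideal A} {m : FormIndex o → ℕ}

-- After removal of one factor `x`, the exponent of `x` is still larger than that of each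
-- replacement `k`, and `m k < h`, so by concavity the exchange strictly gains weight.
omit [DecidableEq X] in
lemma formMonomial_mem_of_exchange
    (IH : ∀ m' : FormIndex o → ℕ, totalWeight h m < totalWeight h m' → N ≤ ∑ k, m' k →
      formMonomial o a m' ∈ J)
    (hm : N ≤ ∑ k, m k) {x : FormIndex o} (hx : 0 < m x)
    (hspan : form o a x ∈ Submodule.span ℚ (form o a '' {k | m k < h ∧ m k + 1 < m x})) :
    formMonomial o a m ∈ J := by
  classical
  obtain ⟨m', rfl, hx', hk'⟩ := exists_eq_add_single hx
  refine formMonomial_exchange hspan fun k hk => IH _ ?_ ?_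
  · obtain ⟨h1, h2⟩ := hk
    have hne : k ≠ x := by rintro rfl; omega
    rw [← hk' k hne] at h1 h2
    rw [totalWeight_add_single, totalWeight_add_single]
    omega
  · rwa [sum_add_single] at hm ⊢

-- Otherwise a connected component is a cut all of whose crossing forms have exponent at least `h`.
omit [Algebra ℚ A] in
lemma preconnected_of_notMem (hJ : ContainsGoodMonomials a h J) (ho : Function.Injective o)
    (hm : powerBound h (Fintype.card X) ≤ ∑ k, m k) (hmem : formMonomial o a m ∉ J) :
    (pairGraph o fun p => ∃ s, m (Sum.inr (p, s)) < h).Preconnected := by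
  classical
  intro i j
  by_contra hij
  set G := pairGraph o fun p => ∃ s, m (Sum.inr (p, s)) < h with hG
  refine hmem (formMonomial_mem_of_cut hJ ho hm (V := Finset.univ.filter fun k => G.Reachable i k)
    ⟨i, by simp⟩ (fun hV => hij ?_) fun p hp s => ?_)
  · have := Finset.mem_univ j
    rw [← hV] at this
    simpa using this
  · by_contra hs
    have hr : G.Reachable p.1.1 p.1.2 := pairGraph_reachable ⟨s, not_le.1 hs⟩
    refine hp ?_
    simp only [Finset.mem_filter, Finset.mem_univ, true_and]
    exact ⟨fun h => h.trans hr, fun h => h.trans hr.symm⟩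

lemma units_smul_mem {W : Submodule ℚ A} (s : ℤˣ) {x : A} (hx : x ∈ W) :
    ((s : ℤ) : A) * x ∈ W := by
  rcases Int.units_eq_one_or s with rfl | rfl <;> simpa using hx

omit [Algebra ℚ A] in
lemma units_mul_self_cast (s : ℤˣ) : ((s : ℤ) : A) * ((s : ℤ) : A) = 1 := by
  rcases Int.units_eq_one_or s with rfl | rfl <;> simp

omit [DecidableEq X] in
/-- Either some monomial is a combination of heavier ones, or its forms of low exponent are
consistent with a choice of signs. -/
lemma exists_signs (ho : Function.Injective o)
    (IH : ∀ m' : FormIndex o → ℕ, totalWeight h m < totalWeight h m' →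
      powerBound h (Fintype.card X) ≤ ∑ k, m' k → formMonomial o a m' ∈ J)
    (hm : powerBound h (Fintype.card X) ≤ ∑ k, m k) (hmem : formMonomial o a m ∉ J)
    (hconn : (pairGraph o fun p => ∃ s, m (Sum.inr (p, s)) < h).Preconnected) :
    ∃ ε : X → ℤˣ, (∀ i, h ≤ m (Sum.inl i)) ∧
      ∀ p : Pairs o, h ≤ m (Sum.inr (p, ε p.1.1 * ε p.1.2)) := by
  by_cases hfree : ∃ x, h < m x
  swap
  -- There are `n²` forms and the degree is at least `h n²`, so all exponents equal `h` and any
  -- signs do.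
  · push Not at hfree
    have heq : ∀ k, m k = h := by
      by_contra hne
      push Not at hne
      obtain ⟨k, hk⟩ := hne
      have : ∑ k, m k < ∑ _k : FormIndex o, h :=
        Finset.sum_lt_sum (fun k _ => hfree k) ⟨k, Finset.mem_univ k, lt_of_le_of_ne (hfree k) hk⟩
      rw [Finset.sum_const, Finset.card_univ, card_formIndex ho, smul_eq_mul] at this
      unfold powerBound at hm
      nlinarith
    exact ⟨fun _ => 1, fun i => (heq _).ge, fun p => (heq _).ge⟩
  obtain ⟨x, hx⟩ := hfree
  set W := Submodule.span ℚ (form o a '' {k | m k < h}) with hW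
  have hlow : ∀ k, m k < h → form o a k ∈ W := fun k hk => Submodule.subset_span ⟨k, hk, rfl⟩
  -- Since `m x > h`, every form of exponent below `h` is an admissible replacement for `x`.
  have hxW : form o a x ∉ W := by
    refine fun hxW => hmem (formMonomial_mem_of_exchange IH hm (Nat.zero_lt_of_lt hx)
      (Submodule.span_mono (Set.image_mono ?_) hxW))
    exact fun k hk => ⟨hk, lt_of_le_of_lt hk hx⟩
  obtain ⟨i₀, hi₀⟩ : ∃ i, a i ∉ W := by
    by_contra hall
    push Not at hall
    refine hxW ?_
    rcases x with i | ⟨p, s⟩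
    · exact hall i
    · exact W.add_mem (hall _) (units_smul_mem s (hall _))
  -- Being equal up to sign modulo `W` is an equivalence relation. Low pairs satisfy it and connect
  -- `X`, so every `a i` is `± a i₀` modulo `W`.
  have hrel : Equivalence fun i j => ∃ s : ℤˣ, a i - ((s : ℤ) : A) * a j ∈ W := by
    refine ⟨fun i => ⟨1, by simp⟩, ?_, ?_⟩
    · rintro i j ⟨s, hs⟩
      refine ⟨s, ?_⟩
      have := units_smul_mem (-s) hs
      convert this using 1
      push_cast
      linear_combination (-a j) * units_mul_self_cast (A := A) s
    · rintro i j k ⟨s, hs⟩ ⟨t, ht⟩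
      refine ⟨s * t, ?_⟩
      have := W.add_mem hs (units_smul_mem s ht)
      convert this using 1
      push_cast
      ring
  have hall : ∀ i, ∃ s : ℤˣ, a i₀ - ((s : ℤ) : A) * a i ∈ W := fun i =>
    rel_of_pairGraph_reachable hrel (fun p ⟨s, hs⟩ => ⟨-s, by
      have := hlow _ hs
      simpa [form] using this⟩) (hconn i₀ i)
  choose ε hε using hall
  have hnot : ∀ i, a i ∉ W := fun i hi => hi₀ <| by
    have := W.add_mem (hε i) (units_smul_mem (ε i) hi)
    simpa using this
  refine ⟨ε, fun i => ?_, fun p => ?_⟩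
  · by_contra hi
    exact hnot i (hlow _ (not_le.1 hi))
  · by_contra hp
    have h1 := hlow _ (not_le.1 hp)
    have h2 := units_smul_mem (ε p.1.1) (W.sub_mem (hε p.1.2) (hε p.1.1))
    refine hnot p.1.1 ?_
    -- Modulo `W` the major form at `p` is `2 • a p.1.1`, so a low exponent would put `a p.1.1` into
    -- `W`.
    have h3 := W.smul_mem (1 / 2 : ℚ) (W.add_mem h1 h2)
    convert h3 using 1
    have e : form o a (Sum.inr (p, ε p.1.1 * ε p.1.2)) + ((ε p.1.1 : ℤ) : A) *
        (a i₀ - ((ε p.1.2 : ℤ) : A) * a p.1.2 - (a i₀ - ((ε p.1.1 : ℤ) : A) * a p.1.1))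
        = (2 : ℚ) • a p.1.1 := by
      rw [form, ofNat_smul_eq_nsmul ℚ 2 (a p.1.1)]
      push_cast
      linear_combination a p.1.1 * units_mul_self_cast (A := A) (ε p.1.1)
    rw [e, smul_smul]
    norm_num

end Rewriting


/-! ### Major and minor forms, and reduction to a good monomial -/

section Majors

variable {X : Type*} [Fintype X] [DecidableEq X] {A : Type*} [CommRing A] [Algebra ℚ A]
  {o : X → ℕ} {a : X → A} {h N : ℕ} {J : Ideal A} {m : FormIndex o → ℕ}

/-- The indices of the forms `a i` and `a i + ε i ε j a j`. -/
def major (ε : X → ℤˣ) : X ⊕ Pairs o → FormIndex o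
  | Sum.inl i => Sum.inl i
  | Sum.inr p => Sum.inr (p, ε p.1.1 * ε p.1.2)

/-- The indices of the forms `a i - ε i ε j a j`. -/
def minor (ε : X → ℤˣ) (p : Pairs o) : FormIndex o := Sum.inr (p, -(ε p.1.1 * ε p.1.2))

omit [Fintype X] [DecidableEq X] in
lemma major_ne_minor (ε : X → ℤˣ) (x : X ⊕ Pairs o) (p : Pairs o) : major ε x ≠ minor ε p := by
  rcases x with i | p'
  · simp [major, minor]
  · simp only [major, minor, ne_eq, Sum.inr.injEq, Prod.mk.injEq, not_and]
    rintro rfl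
    exact units_ne_neg_self _

omit [Fintype X] [DecidableEq X] in
lemma eq_major_or_minor (ε : X → ℤˣ) (k : FormIndex o) :
    (∃ x, k = major ε x) ∨ ∃ p, k = minor ε p := by
  rcases k with i | ⟨p, s⟩
  · exact Or.inl ⟨Sum.inl i, rfl⟩
  · rcases eq_or_ne s (ε p.1.1 * ε p.1.2) with rfl | hs
    · exact Or.inl ⟨Sum.inr p, rfl⟩
    · refine Or.inr ⟨p, ?_⟩
      rw [minor, Int.units_ne_iff_eq_neg.1 hs]

omit [DecidableEq X] in
lemma sum_eq_sum_major_add_sum_minor (ε : X → ℤˣ) (f : FormIndex o → ℕ) :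
    ∑ k, f k = ∑ x, f (major ε x) + ∑ p, f (minor ε p) := by
  rw [sum_formIndex ε, Fintype.sum_sum_type, Finset.sum_add_distrib, add_assoc]
  rfl

-- Along a path, the minor forms, multiplied by signs, telescope.
omit [Fintype X] [DecidableEq X] in
lemma sub_mem_span_minor {ε : X → ℤˣ} {q : Pairs o → ℕ} {l : ℕ} {i j : X}
    (hij : (levelGraph q l).Reachable i j) :
    ((ε i : ℤ) : A) * a i - ((ε j : ℤ) : A) * a j ∈
      Submodule.span ℚ (form o a '' (minor ε '' {p | q p < l})) := by
  set W := Submodule.span ℚ (form o a '' (minor ε '' {p | q p < l}))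
  refine rel_of_pairGraph_reachable
    (r := fun i j => ((ε i : ℤ) : A) * a i - ((ε j : ℤ) : A) * a j ∈ W)
    ⟨fun i => by simp, fun {i j} hi => ?_, fun {i j k} hi hj => ?_⟩ (fun p hp => ?_) hij
  · rw [← neg_sub]; exact W.neg_mem hi
  · rw [← sub_add_sub_cancel]; exact W.add_mem hi hj
  · have h1 : form o a (minor ε p) ∈ W := Submodule.subset_span ⟨_, ⟨p, hp, rfl⟩, rfl⟩
    convert units_smul_mem (ε p.1.1) h1 using 1
    rw [minor, form]
    push_cast
    linear_combination
      (((ε p.1.2 : ℤ) : A) * a p.1.2) * units_mul_self_cast (A := A) (ε p.1.1)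

-- If `q p` exceeded the bottleneck, the minor form at `p` would be a combination of minor forms
-- with exponents at least two smaller, and exchange would apply.
omit [DecidableEq X] in
lemma minor_le_bottleneck
    (IH : ∀ m' : FormIndex o → ℕ, totalWeight h m < totalWeight h m' → N ≤ ∑ k, m' k →
      formMonomial o a m' ∈ J)
    (hm : N ≤ ∑ k, m k) (hmem : formMonomial o a m ∉ J) {ε : X → ℤˣ} {q : Pairs o → ℕ}
    (hq : ∀ p, m (minor ε p) = q p) (hconn : (levelGraph q h).Preconnected) (p : Pairs o) :
    q p ≤ bottleneck q p := by
  by_contra! hp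
  have hh : bottleneck q p ≤ h := (levelGraph_reachable_iff q p h).1 (hconn _ _)
  have hW := sub_mem_span_minor (A := A) (a := a) (ε := ε)
    ((levelGraph_reachable_iff q p _).2 le_rfl)
  refine hmem (formMonomial_mem_of_exchange IH hm (x := minor ε p) (by rw [hq]; omega) ?_)
  have h1 := units_smul_mem (ε p.1.1) hW
  refine Submodule.span_mono (Set.image_mono ?_) (?_ : form o a (minor ε p) ∈
    Submodule.span ℚ (form o a '' (minor ε '' {p' | q p' < bottleneck q p})))
  · rintro _ ⟨p', hp', rfl⟩
    simp only [Set.mem_ofPred_eq, hq] at hp' ⊢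
    omega
  · convert h1 using 1
    rw [minor, form]
    push_cast
    linear_combination (-a p.1.1) * units_mul_self_cast (A := A) (ε p.1.1)

-- Once all `ε i a i` agree modulo `W`, each major form is `±1` or `±2` times their common value.
-- That `c` is nonzero allows one major form to be solved for in terms of another.
omit [Fintype X] [DecidableEq X] in
lemma exists_major_sub_smul_mem {ε : X → ℤˣ} {W : Submodule ℚ A}
    (hW : ∀ i j, ((ε i : ℤ) : A) * a i - ((ε j : ℤ) : A) * a j ∈ W) (i₀ : X) (x : X ⊕ Pairs o) :
    ∃ c : ℚ, c ≠ 0 ∧ form o a (major ε x) - c • (((ε i₀ : ℤ) : A) * a i₀) ∈ W := by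
  have hcast : ∀ (s : ℤˣ) (z : A), ((s : ℤ) : A) * z = ((s : ℤ) : ℚ) • z := by
    intro s z
    rcases Int.units_eq_one_or s with rfl | rfl <;> simp
  rcases x with i | p
  · refine ⟨((ε i : ℤ) : ℚ), by simp, ?_⟩
    rw [← hcast, major, form]
    convert units_smul_mem (ε i) (hW i i₀) using 1
    linear_combination (-a i) * units_mul_self_cast (A := A) (ε i)
  · refine ⟨((ε p.1.1 : ℤ) : ℚ) * 2, by simp, ?_⟩
    rw [mul_smul, ← hcast, ofNat_smul_eq_nsmul ℚ 2, major, form]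
    convert units_smul_mem (ε p.1.1) (W.add_mem (hW p.1.1 i₀) (hW p.1.2 i₀)) using 1
    push_cast
    linear_combination (-a p.1.1) * units_mul_self_cast (A := A) (ε p.1.1)

/-- Modulo heavier monomials, the factors `major` in excess of `h` can be exchanged freely. -/
lemma formMonomial_mem_of_major
    (IH : ∀ m' : FormIndex o → ℕ, totalWeight h m < totalWeight h m' → N ≤ ∑ k, m' k →
      formMonomial o a m' ∈ J)
    {ε : X → ℤˣ} {q : Pairs o → ℕ} (hconn : (levelGraph q h).Preconnected)
    {T : FormIndex o → ℕ} (hT : formMonomial o a T ∈ J) (hTh : ∀ x, h ≤ T (major ε x))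
    (hTq : ∀ p, T (minor ε p) ≤ q p) (hN : ∑ x, T (major ε x) + ∑ p, q p ≤ N) (d : ℕ) :
    ∀ m' : FormIndex o → ℕ, (∀ p, m' (minor ε p) = q p) → (∀ x, h ≤ m' (major ε x)) →
      totalWeight h m ≤ totalWeight h m' → N ≤ ∑ k, m' k → ∑ k, (T k - m' k) ≤ d →
      formMonomial o a m' ∈ J := by
  classical
  induction d with
  | zero =>
    intro m' _ _ _ _ hd
    have hle : T ≤ m' := fun k => by
      exact Nat.sub_eq_zero_iff_le.1
        (Finset.sum_eq_zero_iff.1 (Nat.le_zero.1 hd) k (Finset.mem_univ k))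
    exact J.mem_of_dvd (formMonomial_dvd hle) hT
  | succ d ihd =>
    intro m₁ hmin hmaj hwt hsum hd
    by_cases hle : T ≤ m₁
    · exact J.mem_of_dvd (formMonomial_dvd hle) hT
    obtain ⟨k, hk⟩ : ∃ k, m₁ k < T k := by
      by_contra! hcon
      exact hle hcon
    obtain ⟨y, rfl⟩ : ∃ y, k = major ε y := by
      rcases eq_major_or_minor ε k with hy | ⟨p, rfl⟩
      · exact hy
      · rw [hmin] at hk
        exact absurd (hTq p) (not_le.2 hk)
    -- By `hN` the monomial has at least as many major factors as `T`; a deficit at `y` forces an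
    -- excess elsewhere.
    obtain ⟨x, hx⟩ : ∃ x, T (major ε x) < m₁ (major ε x) := by
      by_contra! hcon
      have h1 : ∑ x, m₁ (major ε x) < ∑ x, T (major ε x) :=
        Finset.sum_lt_sum (fun x _ => hcon x) ⟨y, Finset.mem_univ y, hk⟩
      rw [sum_eq_sum_major_add_sum_minor ε] at hsum
      simp only [hmin] at hsum
      omega
    obtain ⟨m', rfl, hx', hk'⟩ := exists_eq_add_single (lt_of_le_of_lt (Nat.zero_le _) hx)
    have hyx : major ε y ≠ major ε x := by
      intro e
      rw [e] at hk
      omega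
    have hxh := hTh x
    -- The removed factor has exponent above `T (major ε x) ≥ h`, so it carried no weight.
    have hwt' : totalWeight h m ≤ totalWeight h m' := by
      rw [totalWeight_add_single] at hwt
      omega
    have hmin' : ∀ p, m' (minor ε p) = q p := fun p => by
      rw [hk' _ (major_ne_minor ε x p).symm, hmin]
    rw [sum_add_single] at hsum
    have hspan : form o a (major ε x) ∈ Submodule.span ℚ
        (form o a '' insert (major ε y) (minor ε '' {p | q p < h})) := by
      set W := Submodule.span ℚ (form o a '' insert (major ε y) (minor ε '' {p | q p < h}))
      have hW : ∀ i j, ((ε i : ℤ) : A) * a i - ((ε j : ℤ) : A) * a j ∈ W := fun i j =>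
        Submodule.span_mono (Set.image_mono (Set.subset_insert _ _))
          (sub_mem_span_minor (hconn i j))
      have hyW : form o a (major ε y) ∈ W :=
        Submodule.subset_span ⟨_, Set.mem_insert _ _, rfl⟩
      obtain ⟨i₀⟩ : Nonempty X := by
        rcases y with i | p
        exacts [⟨i⟩, ⟨p.1.1⟩]
      obtain ⟨c, hc, hcW⟩ := exists_major_sub_smul_mem hW i₀ y
      obtain ⟨c', -, hcW'⟩ := exists_major_sub_smul_mem hW i₀ x
      have h1 := (W.sub_mem_iff_right hyW).1 hcW
      rw [W.smul_mem_iff hc] at h1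
      exact (W.sub_mem_iff_left (W.smul_mem c' h1)).1 hcW'
    refine formMonomial_exchange hspan ?_
    rintro k (rfl | ⟨p, hp, rfl⟩)
    -- Exchange for the deficient major `y`: the total deficit with respect to `T` drops.
    · refine ihd _ ?_ ?_ ?_ ?_ ?_
      · intro p
        rw [Pi.add_apply, Pi.single_eq_of_ne (major_ne_minor ε y p).symm, add_zero, hmin']
      · intro z
        refine le_trans ?_ (Nat.le_add_right (m' (major ε z)) _)
        by_cases hz : major ε z = major ε x
        · rw [hz]; omega
        · rw [hk' _ hz]
          exact hmaj z
      · rw [totalWeight_add_single]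
        omega
      · rwa [sum_add_single]
      · refine Nat.lt_succ_iff.1 (lt_of_lt_of_le (Finset.sum_lt_sum (fun k _ => ?_)
          ⟨major ε y, Finset.mem_univ _, ?_⟩) hd)
        · by_cases hkx : k = major ε x
          · subst hkx
            simp only [Pi.add_apply]
            omega
          · simp only [Pi.add_apply, Pi.single_eq_of_ne hkx]
            omega
        · simp only [Pi.add_apply, Pi.single_eq_of_ne hyx, Pi.single_eq_same] at hk ⊢
          omega
    -- Exchange for a minor with `q p < h`: the weight strictly increases.
    · refine IH _ ?_ ?_
      · rw [totalWeight_add_single, hmin']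
        have : q p < h := hp
        omega
      · rwa [sum_add_single]

/-- The exponents of the good monomial attached to signs and bottleneck levels. -/
def levelExponent (h : ℕ) (ε : X → ℤˣ) (ρ : Pairs o → ℕ) : FormIndex o → ℕ
  | Sum.inl _ => h
  | Sum.inr (p, s) => if s = ε p.1.1 * ε p.1.2 then 2 * h + 1 - ρ p else ρ p - 1

omit [Fintype X] [DecidableEq X] in
lemma levelExponent_minor (h : ℕ) (ε : X → ℤˣ) (ρ : Pairs o → ℕ) (p : Pairs o) :
    levelExponent h ε ρ (minor ε p) = ρ p - 1 := by
  rw [minor, levelExponent, if_neg]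
  exact (units_ne_neg_self _).symm

omit [Fintype X] [DecidableEq X] in
lemma levelExponent_major_inr (h : ℕ) (ε : X → ℤˣ) (ρ : Pairs o → ℕ) (p : Pairs o) :
    levelExponent h ε ρ (major ε (Sum.inr p)) = 2 * h + 1 - ρ p := by
  rw [major, levelExponent, if_pos rfl]

lemma sum_level_ge {h ρ : ℕ} (h1 : 0 < ρ) (h2 : ρ ≤ h) :
    ∑ l : Fin h, (if ρ ≤ l + 1 then 2 else 1) = 2 * h + 1 - ρ ∧
      ∑ l : Fin h, (if ρ ≤ l + 1 then 0 else 1) = ρ - 1 := by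
  rw [Fin.sum_univ_eq_sum_range (fun l => if ρ ≤ l + 1 then 2 else 1),
    Fin.sum_univ_eq_sum_range (fun l => if ρ ≤ l + 1 then 0 else 1)]
  have key : ∀ n, ∑ l ∈ Finset.range n, (if ρ ≤ l + 1 then 2 else 1) = 2 * n - min n (ρ - 1) ∧
      ∑ l ∈ Finset.range n, (if ρ ≤ l + 1 then 0 else 1) = min n (ρ - 1) := by
    intro n
    induction n with
    | zero => simp
    | succ n ih =>
      rw [Finset.sum_range_succ, Finset.sum_range_succ, ih.1, ih.2]
      split_ifs <;> omega
  have := key h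
  omega

omit [Algebra ℚ A] in
lemma associated_units_mul (s : ℤˣ) (x : A) : Associated (((s : ℤ) : A) * x) x := by
  rcases Int.units_eq_one_or s with rfl | rfl
  · simp
  · exact ⟨-1, by simp⟩

-- Level `l` contributes the major form of `p` twice if the ends of `p` have equal level, and
-- otherwise one major and one minor factor. The diagonal gives `2 a i`, with `2` invertible.
omit [DecidableEq X] in
lemma associated_level (ho : Function.Injective o) (ε : X → ℤˣ) {ρ : Pairs o → ℕ}
    (h1 : ∀ p, 0 < ρ p) (h2 : ∀ p, ρ p ≤ h) {c : Fin h → X → ℕ}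
    (hc : ∀ l p, c l p.1.1 = c l p.1.2 ↔ ρ p ≤ l + 1) :
    Associated (∏ l, ∏ i, ∏ j, levelFactor a ε (c l) i j)
      (formMonomial o a (levelExponent h ε ρ)) := by
  have h3 : ∏ l, ∏ i, ∏ j, levelFactor a ε (c l) i j = (∏ i, (a i + a i) ^ h) *
      ∏ p : Pairs o, ∏ l, levelFactor a ε (c l) p.1.1 p.1.2 *
        levelFactor a ε (c l) p.1.2 p.1.1 := by
    simp only [prod_prod_eq_diag_mul_pairs ho, Finset.prod_mul_distrib]
    congr 1
    · rw [Finset.prod_comm]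
      simp [levelFactor]
    · congr 1 <;> exact Finset.prod_comm
  rw [h3, formMonomial, prod_formIndex ε]
  refine Associated.mul_mul (Associated.prod _ _ _ fun i _ => ?_)
    (Associated.prod _ _ _ fun p _ => ?_)
  · refine Associated.pow_pow ?_
    have h2u : IsUnit (2 : A) := by
      have := (IsUnit.mk0 (2 : ℚ) two_ne_zero).map (algebraMap ℚ A)
      rwa [map_ofNat] at this
    rw [form, ← two_mul]
    exact (associated_isUnit_mul_left_iff h2u).2 (Associated.refl _)
  · have e1 := levelExponent_major_inr h ε ρ p
    have e2 := levelExponent_minor h ε ρ p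
    rw [major] at e1
    rw [minor] at e2
    rw [e1, e2, ← (sum_level_ge (h1 p) (h2 p)).1, ← (sum_level_ge (h1 p) (h2 p)).2,
      ← Finset.prod_pow_eq_pow_sum, ← Finset.prod_pow_eq_pow_sum, ← Finset.prod_mul_distrib]
    refine Associated.prod _ _ _ fun l _ => ?_
    by_cases hl : ρ p ≤ l + 1
    · have he := (hc l p).2 hl
      rw [if_pos hl, if_pos hl, pow_zero, mul_one, pow_two]
      have hs : a p.1.2 + (((ε p.1.2 * ε p.1.1 : ℤˣ) : ℤ) : A) * a p.1.1
          = (((ε p.1.1 * ε p.1.2 : ℤˣ) : ℤ) : A) *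
            form o a (Sum.inr (p, ε p.1.1 * ε p.1.2)) := by
        rw [form, mul_comm (ε p.1.2)]
        linear_combination (-a p.1.2) * units_mul_self_cast (A := A) (ε p.1.1 * ε p.1.2)
      simp only [levelFactor, he, lt_irrefl, if_true, if_false, hs]
      exact Associated.mul_mul (Associated.refl _) (associated_units_mul _ _)
    · have he : c l p.1.1 ≠ c l p.1.2 := fun he => hl ((hc l p).1 he)
      rw [if_neg hl, if_neg hl, pow_one, pow_one]
      rcases lt_or_gt_of_ne he with hlt | hlt
      · simp only [levelFactor, hlt, hlt.not_gt, hlt.ne', if_true, if_false, mul_one]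
        exact associated_form_mul_form p (Or.inl ⟨rfl, rfl⟩) _
      · simp only [levelFactor, hlt, hlt.not_gt, hlt.ne', if_true, if_false, one_mul]
        exact associated_form_mul_form p (Or.inr ⟨rfl, rfl⟩) _

lemma levelExponent_mem (hJ : ContainsGoodMonomials a h J) (ho : Function.Injective o)
    (ε : X → ℤˣ) {q : Pairs o → ℕ} (hconn : (levelGraph q h).Preconnected) :
    formMonomial o a (levelExponent h ε (bottleneck q)) ∈ J := by
  -- Level `l` is cut out by the components of the graph at `l + 1`, since `Fin h` starts at `0` and
  -- the graph at `0` has no edges.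
  choose c hc using fun l : ℕ => exists_level_function _
    (SimpleGraph.reachable_is_equivalence (levelGraph q (l + 1)))
  obtain ⟨u, hu⟩ := associated_level (a := a) ho ε (bottleneck_pos q)
    (fun p => (levelGraph_reachable_iff q p h).1 (hconn _ _)) (c := fun l : Fin h => c l)
    fun l p => (hc l _ _).trans (levelGraph_reachable_iff q p _)
  rw [← hu]
  exact J.mul_mem_right _ (hJ.level ε _)

lemma formMonomial_mem (hJ : ContainsGoodMonomials a h J) (ho : Function.Injective o)
    (m : FormIndex o → ℕ) (hm : powerBound h (Fintype.card X) ≤ ∑ k, m k) :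
    formMonomial o a m ∈ J := by
  induction hw : Fintype.card (FormIndex o) * (h * h) - totalWeight h m
    using Nat.strong_induction_on generalizing m with
  | _ w ih =>
  have IH : ∀ m' : FormIndex o → ℕ, totalWeight h m < totalWeight h m' →
      powerBound h (Fintype.card X) ≤ ∑ k, m' k → formMonomial o a m' ∈ J := by
    intro m' hlt hm'
    have := totalWeight_le h m'
    exact ih _ (by omega) m' hm' rfl
  by_contra hmem
  have hconn := preconnected_of_notMem hJ ho hm hmem
  obtain ⟨ε, hε, hε'⟩ := exists_signs ho IH hm hmem hconn
  let q : Pairs o → ℕ := fun p => m (minor ε p)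
  have hconn' : (levelGraph q h).Preconnected := by
    -- Major exponents are at least `h`, so a low form on a pair must be its minor form.
    refine fun i j => (hconn i j).mono (pairGraph_mono ?_)
    rintro p ⟨s, hs⟩
    rcases eq_or_ne s (ε p.1.1 * ε p.1.2) with rfl | hne
    · exact absurd (hε' p) (not_le.2 hs)
    · rwa [Int.units_ne_iff_eq_neg.1 hne] at hs
  have hq := minor_le_bottleneck IH hm hmem (ε := ε) (q := q) (fun _ => rfl) hconn'
  have hle : ∀ p, bottleneck q p ≤ h := fun p => (levelGraph_reachable_iff q p h).1 (hconn' _ _)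
  refine hmem (formMonomial_mem_of_major IH (ε := ε) hconn' (levelExponent_mem hJ ho ε hconn')
    ?_ ?_ ?_ _ m (fun _ => rfl) ?_ le_rfl hm le_rfl)
  · rintro (i | p)
    · exact le_rfl
    · rw [levelExponent_major_inr]
      have := hle p
      omega
  · intro p
    rw [levelExponent_minor]
    have := bottleneck_le q p
    omega
  -- The major and minor exponents of `T` at a pair add up to `2h`, so `T` has degree `h n²`;
  -- replacing its minor part by `∑ q` adds at most `(n - 1)(n - 2) / 2`.
  · have h1 := sum_le_sum_bottleneck ho hconn' hq
    have h2 := card_add_two_mul_card_pairs ho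
    have h3 : ∑ p, (2 * h + 1 - bottleneck q p) + ∑ p, (bottleneck q p - 1)
        = 2 * h * Fintype.card (Pairs o) := by
      rw [← Finset.sum_add_distrib, Finset.sum_congr rfl (g := fun _ => 2 * h)]
      · simp [mul_comm]
      · intro p _
        have := hle p
        have := bottleneck_pos q p
        omega
    rw [Fintype.sum_sum_type]
    simp only [levelExponent_major_inr]
    have h4 : ∑ i : X, levelExponent h ε (bottleneck q) (major ε (Sum.inl i))
        = h * Fintype.card X := by
      simp [major, levelExponent, mul_comm]
    rw [h4, powerBound, ← h2]
    nlinarith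
  · rintro (i | p)
    · exact hε i
    · exact hε' p

/-- An ideal that contains the good monomials contains all products of `powerBound h n`
of the `a i`. -/
theorem pow_le_of_containsGoodMonomials (hJ : ContainsGoodMonomials a h J) :
    Ideal.span (Set.range a) ^ powerBound h (Fintype.card X) ≤ J := by
  let o : X → ℕ := fun i => Fintype.equivFin X i
  have ho : Function.Injective o := Fin.val_injective.comp (Fintype.equivFin X).injective
  -- The factors of `x` are absorbed one at a time into the monomial.
  have key : ∀ d (m : FormIndex o → ℕ), powerBound h (Fintype.card X) ≤ ∑ k, m k + d →
      ∀ x ∈ Ideal.span (Set.range a) ^ d, formMonomial o a m * x ∈ J := by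
    intro d
    induction d with
    | zero => exact fun m hm x _ => J.mul_mem_right _ (formMonomial_mem hJ ho m hm)
    | succ d ih =>
      intro m hm x hx
      rw [pow_succ'] at hx
      refine Submodule.mul_induction_on hx (fun y hy z hz => ?_) fun y z hy hz => ?_
      · induction hy using Submodule.span_induction with
        | mem y hy =>
          obtain ⟨i, rfl⟩ := hy
          have h1 : formMonomial o a (m + Pi.single (Sum.inl i) 1) = formMonomial o a m * a i := by
            rw [formMonomial_add, formMonomial_single, form]
          rw [← mul_assoc, ← h1]
          refine ih _ ?_ z hz
          rw [sum_add_single]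
          omega
        | zero => simp
        | add u v _ _ hu hv => rw [add_mul, mul_add]; exact J.add_mem hu hv
        | smul r u _ hu =>
          rw [smul_eq_mul, mul_assoc, mul_left_comm]
          exact J.mul_mem_left _ hu
      · rw [mul_add]; exact J.add_mem hy hz
  intro x hx
  have := key _ 0 (by simp) x hx
  simpa [formMonomial] using this

end Majors


/-! ### Collections of sections as products of linear forms -/

section SectionProducts

variable {X : Type*} [DecidableEq X] {S : Type*} [CommRing S] {g : ℕ}

/-- The product of the linear forms `a i ± a j` over a collection of sections. -/
def sectionProduct (a : X → S) (P : Finset (Sec X g)) : S :=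
  ∏ σ ∈ P, (a σ.2.1 + ((σ.1 : ℤ) : S) * a σ.2.2.1)

lemma prod_push {Z M : Type*} [CommMonoid M] {ψ : Z → X} (hψ : Function.Injective ψ)
    (P : Finset (Sec Z g)) (F : ℤˣ → X → X → M) :
    ∏ σ ∈ push ψ P, F σ.1 σ.2.1 σ.2.2.1 = ∏ σ ∈ P, F σ.1 (ψ σ.2.1) (ψ σ.2.2.1) := by
  rw [push, Finset.prod_image]
  rintro ⟨s, i, j, l⟩ - ⟨s', i', j', l'⟩ - h
  simp only [Prod.mk.injEq] at h
  obtain ⟨rfl, h1, h2, rfl⟩ := h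
  rw [hψ h1, hψ h2]

lemma sectionProduct_push {Z : Type*} {ψ : Z → X} (hψ : Function.Injective ψ) (a : X → S)
    (P : Finset (Sec Z g)) : sectionProduct a (push ψ P) = sectionProduct (a ∘ ψ) P :=
  prod_push hψ P fun s i j => a i + ((s : ℤ) : S) * a j

variable [Fintype X]

omit [DecidableEq X] in
lemma prod_sec {M : Type*} [CommMonoid M] (f : Sec X g → M) :
    ∏ σ, f σ = ∏ l, ∏ ij : X × X, ∏ s, f (s, ij.1, ij.2, l) := by
  rw [← Fintype.prod_prod_type' (f := fun l (ij : X × X) => ∏ s, f (s, ij.1, ij.2, l)),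
    ← Fintype.prod_prod_type' (f := fun (t : Fin (2 * g) × X × X) s => f (s, t.2.1, t.2.2, t.1))]
  refine Fintype.prod_equiv ⟨fun σ => ((σ.2.2.2, σ.2.1, σ.2.2.1), σ.1),
    fun t => (t.2, t.1.2.1, t.1.2.2, t.1.1), fun _ => rfl, fun _ => rfl⟩ _ _ fun _ => rfl

lemma prod_Q {M : Type*} [CommMonoid M] (B : Finset (X × X)) (D : Fin (2 * g) → Finset (X × X))
    (F : ℤˣ → X → X → M) :
    ∏ σ ∈ Q B D, F σ.1 σ.2.1 σ.2.2.1 = ∏ l, ((∏ ij ∈ D l, F 1 ij.1 ij.2 * F (-1) ij.1 ij.2) *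
      ∏ ij ∈ Finset.univ.filter (fun ij => ij ∉ D l ∪ bar (D l)),
        F (-eps B ij.1 ij.2) ij.1 ij.2) := by
  rw [Q, Finset.prod_filter, prod_sec]
  refine Finset.prod_congr rfl fun l _ => ?_
  have h1 : ∏ ij ∈ D l, F 1 ij.1 ij.2 * F (-1) ij.1 ij.2
      = ∏ ij : X × X, if ij ∈ D l then F 1 ij.1 ij.2 * F (-1) ij.1 ij.2 else 1 := by
    rw [Finset.prod_ite_mem, Finset.univ_inter]
  rw [h1, Finset.prod_filter, ← Finset.prod_mul_distrib]
  refine Finset.prod_congr rfl fun ij _ => ?_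
  by_cases h2 : ij ∈ D l
  · rw [prod_units_int _ 1]
    simp [h2]
  · by_cases h3 : ij ∈ bar (D l)
    · simp [h2, h3]
    · rw [prod_units_int _ (-eps B ij.1 ij.2)]
      simp [h2, h3, units_ne_neg_self]

/-- Take the block of `V = {i | ε i = -1}`: it separates `i` from `j` exactly when `ε i ε j = -1`.
Constant signs correspond to the empty set. -/
lemma exists_eps_eq (ε : X → ℤˣ) :
    ∃ B ∈ insert ∅ (blocks X), ∀ i j, -eps B i j = ε i * ε j := by
  let V : Finset X := Finset.univ.filter fun i => ε i = -1
  have hV : ∀ i, i ∈ V ↔ ε i = -1 := by simp [V]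
  have hV' : ∀ i, i ∉ V ↔ ε i = 1 := fun i => by
    rw [hV]
    rcases Int.units_eq_one_or (ε i) with h | h <;> simp [h]
  by_cases hp : V ∈ properSubsets X
  · refine ⟨block V, Finset.mem_insert_of_mem (Finset.mem_image_of_mem _ hp), fun i j => ?_⟩
    by_cases hi : i ∈ V <;> by_cases hj : j ∈ V <;>
      simp [eps, block, bar, hi, hj, (hV i).1, (hV j).1, (hV' i).1, (hV' j).1]
  · refine ⟨∅, Finset.mem_insert_self _ _, fun i j => ?_⟩
    have : (∀ i, i ∉ V) ∨ ∀ i, i ∈ V := by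
      simp only [properSubsets, Finset.mem_filter, Finset.mem_univ, true_and, not_and_or,
        Finset.not_nonempty_iff_eq_empty, not_not] at hp
      rcases hp with h | h <;> simp [h]
    rcases this with h | h
    · simp [eps, bar, (hV' i).1 (h i), (hV' j).1 (h j)]
    · simp [eps, bar, (hV i).1 (h i), (hV j).1 (h j)]

/-- A pair with `c i < c j` lies in the block of the sublevel set `{k | c k ≤ c i}`, which is
contained in the whole set. -/
lemma isUnionOfBlocks_of_level (c : X → ℕ) :
    IsUnionOfBlocks (Finset.univ.filter fun ij : X × X => c ij.1 < c ij.2) := by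
  set D := Finset.univ.filter fun ij : X × X => c ij.1 < c ij.2 with hD
  refine ⟨(blocks X).filter (· ⊆ D), Finset.filter_subset _ _, ?_⟩
  ext ⟨i, j⟩
  simp only [Finset.mem_biUnion, Finset.mem_filter, id]
  constructor
  · intro hij
    have hlt : c i < c j := by simpa [hD] using hij
    refine ⟨block (Finset.univ.filter fun k => c k ≤ c i),
      ⟨Finset.mem_image_of_mem _ ?_, ?_⟩, by simp [block, hlt]⟩
    · simp only [properSubsets, Finset.mem_filter, Finset.mem_univ, true_and]
      refine ⟨⟨i, by simp⟩, fun h => ?_⟩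
      have := Finset.mem_univ j
      rw [← h] at this
      simp only [Finset.mem_filter, Finset.mem_univ, true_and] at this
      omega
    · rintro ⟨k, k'⟩ hk
      simp [block, hD] at hk ⊢
      omega
  · rintro ⟨E, ⟨-, hE⟩, hij⟩
    exact hE hij

lemma exists_Q_sectionProduct_eq (a : X → S) (ε : X → ℤˣ) (c : Fin (2 * g) → X → ℕ) :
    ∃ B ∈ insert ∅ (blocks X), ∃ D : Fin (2 * g) → Finset (X × X), (∀ l, IsUnionOfBlocks (D l)) ∧
      sectionProduct a (Q B D) = ∏ l, ∏ i, ∏ j, levelFactor a ε (c l) i j := by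
  obtain ⟨B, hB, hε⟩ := exists_eps_eq ε
  refine ⟨B, hB, fun l => Finset.univ.filter fun ij : X × X => c l ij.1 < c l ij.2,
    fun l => isUnionOfBlocks_of_level (c l), ?_⟩
  rw [sectionProduct, prod_Q B _ fun s i j => a i + ((s : ℤ) : S) * a j]
  refine Finset.prod_congr rfl fun l _ => ?_
  rw [Finset.prod_filter, Finset.prod_filter, ← Finset.prod_mul_distrib,
    ← Fintype.prod_prod_type' (f := levelFactor a ε (c l))]
  refine Finset.prod_congr rfl fun ij _ => ?_
  simp only [hε, levelFactor, bar, Finset.mem_union, Finset.mem_filter, Finset.mem_univ, true_and,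
    Finset.mem_image, Prod.exists]
  have hbar : (∃ i j, c l i < c l j ∧ (i, j).swap = ij) ↔ c l ij.2 < c l ij.1 :=
    ⟨by rintro ⟨i, j, h, rfl⟩; exact h, fun h => ⟨ij.2, ij.1, h, rfl⟩⟩
  simp only [hbar]
  rcases lt_trichotomy (c l ij.1) (c l ij.2) with h | h | h
  · simp [h, sub_eq_add_neg]
  · simp [h]
  · simp [h, h.not_gt, h.ne']

lemma sectionProduct_crossing (a : X → S) (U : Finset X) :
    sectionProduct a (crossing U : Finset (Sec X g)) = cutProduct a (2 * g) U := by
  rw [sectionProduct, crossing, Finset.prod_filter, prod_sec, cutProduct,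
    ← Finset.prod_product' (f := fun i j => ((a i + a j) * (a i - a j)) ^ (2 * g)),
    Finset.prod_comm]
  have h1 : ∏ ij ∈ U ×ˢ Uᶜ, ((a ij.1 + a ij.2) * (a ij.1 - a ij.2)) ^ (2 * g)
      = ∏ ij : X × X, if ij ∈ U ×ˢ Uᶜ then
        ((a ij.1 + a ij.2) * (a ij.1 - a ij.2)) ^ (2 * g) else 1 := by
    rw [Finset.prod_ite_mem, Finset.univ_inter]
  rw [h1]
  refine Finset.prod_congr rfl fun ij _ => ?_
  simp only [Finset.mem_product, Finset.mem_compl]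
  split_ifs
  · simp [sub_eq_add_neg]
  · simp

variable [Algebra ℚ S]

omit [Fintype X] [DecidableEq X] [CommRing S] [Algebra ℚ S] in
lemma image_eq_range_comp (a : X → S) {V : Finset X} {n : ℕ} (ψ : Fin n ≃ {i // i ∈ V}) :
    a '' (V : Set X) = Set.range (a ∘ fun i => (ψ i : X)) := by
  ext x
  constructor
  · rintro ⟨i, hi, rfl⟩
    exact ⟨ψ.symm ⟨i, hi⟩, by simp⟩
  · rintro ⟨i, rfl⟩
    exact ⟨_, (ψ i).2, rfl⟩

omit [Algebra ℚ S] in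
/-- A criterion for an ideal to contain the good monomials, given the statement for the proper
subsets. -/
lemma containsGoodMonomials_of {a : X → S} {J : Ideal S}
    (hbase : ∀ B ∈ insert ∅ (blocks X), ∀ D : Fin (2 * g) → Finset (X × X),
      (∀ l, IsUnionOfBlocks (D l)) → sectionProduct a (Q B D) ∈ J)
    (hext : ∀ U ∈ properSubsets X, ∀ (ψ : Fin U.card ≃ {i // i ∈ U}) P, A g U.card P →
      cutProduct a (2 * g) U * sectionProduct (a ∘ fun i => (ψ i : X)) P ∈ J)
    (hpow : ∀ U ∈ properSubsets X, ∀ b : Fin U.card → S,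
      Ideal.span (Set.range b) ^ powerBound (2 * g) U.card ≤
        Ideal.span (sectionProduct b '' {P | A g U.card P})) :
    ContainsGoodMonomials a (2 * g) J where
  cut V hV hV' x hx := by
    have hp : V ∈ properSubsets X := by simp [properSubsets, hV, hV']
    have ψ : Fin V.card ≃ {i // i ∈ V} := V.equivFin.symm
    rw [image_eq_range_comp a ψ] at hx
    have hx' := hpow V hp _ hx
    clear hx
    induction hx' using Submodule.span_induction with
    | mem y hy =>
      obtain ⟨P, hP, rfl⟩ := hy
      exact hext V hp ψ P hP
    | zero => simp
    | add u v _ _ hu hv => rw [mul_add]; exact J.add_mem hu hv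
    | smul r u _ hu =>
      rw [smul_eq_mul, mul_left_comm]
      exact J.mul_mem_left _ hu
  level ε c := by
    obtain ⟨B, hB, D, hD, h⟩ := exists_Q_sectionProduct_eq a ε c
    rw [← h]
    exact hbase B hB D hD

/-- Every product of `powerBound (2 * g) n` of the `a i` is a combination of the products attached
to the collections in `𝒜_n`. -/
theorem pow_le_span_sectionProduct (g n : ℕ) (a : Fin n → S) :
    Ideal.span (Set.range a) ^ powerBound (2 * g) n ≤
      Ideal.span (sectionProduct a '' {P | A g n P}) := by
  induction n using Nat.strong_induction_on with
  | _ n ih =>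
  have h : ContainsGoodMonomials a (2 * g) (Ideal.span (sectionProduct a '' {P | A g n P})) := by
    refine containsGoodMonomials_of (fun B hB D hD => Ideal.subset_span ⟨_, A.base B hB D hD, rfl⟩)
      (fun U hU ψ P hP => Ideal.subset_span ⟨_, A.extend U hU ψ P hP, ?_⟩) fun U hU b => ?_
    · have hψ : Function.Injective fun i => (ψ i : Fin n) :=
        Subtype.val_injective.comp ψ.injective
      rw [← sectionProduct_push hψ, ← sectionProduct_crossing,
        mul_comm (sectionProduct a (crossing U)), sectionProduct,
        Finset.prod_union]
      · rfl
      · rw [Finset.disjoint_left]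
        intro σ hσ hσ'
        obtain ⟨τ, -, rfl⟩ := Finset.mem_image.1 hσ
        simp only [crossing, Finset.mem_filter] at hσ'
        exact hσ'.2.2 (ψ _).2
    · refine ih _ ?_ b
      have hlt := Finset.card_lt_univ_of_notMem (s := U) (x := (?_ : Fin n)) ?_
      · simpa using hlt
      all_goals
        simp only [properSubsets, Finset.mem_filter, Finset.mem_univ, true_and] at hU
      · exact (not_forall.1 fun hall => hU.2 (Finset.eq_univ_iff_forall.2 hall)).choose
      · exact (not_forall.1 fun hall => hU.2 (Finset.eq_univ_iff_forall.2 hall)).choose_spec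
  have := pow_le_of_containsGoodMonomials h
  rwa [Fintype.card_fin] at this

end SectionProducts


/-! ### The ring `R` -/

section RingR

variable {X : Type*} [DecidableEq X]

/-- The elements `a i` of `R` with `y^±_{ij} = a i ± a j`. -/
noncomputable def halfDiag (i : X) : R X := (1 / 2 : ℚ) • cls (yPlus i i)

lemma cls_eq_zero {q : YPoly X} (h : q ∈ relIdeal X) : cls q = 0 :=
  Ideal.Quotient.eq_zero_iff_mem.2 h

/-- The defining relations with repeated indices already express everything through the diagonal
`y⁺_{ii}`. -/
lemma two_smul_cls_yPlus (i j : X) :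
    (2 : ℚ) • cls (yPlus i j) = cls (yPlus i i) + cls (yPlus j j) := by
  have h1 : cls (yMinus i j + yMinus j i) = 0 :=
    cls_eq_zero (Ideal.subset_span (Or.inl (Or.inl (Or.inl ⟨i, j, rfl⟩))))
  have h2 : cls (yPlus i j - yPlus j i) = 0 :=
    cls_eq_zero (Ideal.subset_span (Or.inl (Or.inl (Or.inr ⟨i, j, rfl⟩))))
  have h3 : cls (yPlus i j - yPlus j j + yMinus j i) = 0 :=
    cls_eq_zero (Ideal.subset_span (Or.inr ⟨i, j, j, rfl⟩))
  have h4 : cls (yPlus j i - yPlus i i + yMinus i j) = 0 :=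
    cls_eq_zero (Ideal.subset_span (Or.inr ⟨j, i, i, rfl⟩))
  simp only [cls, map_add, map_sub] at *
  rw [ofNat_smul_eq_nsmul ℚ 2]
  linear_combination h2 + h3 + h4 - h1

lemma cls_yMinus (i j : X) : cls (yMinus i j) = cls (yPlus i j) - cls (yPlus j j) := by
  have h1 : cls (yMinus i j + yMinus j i) = 0 :=
    cls_eq_zero (Ideal.subset_span (Or.inl (Or.inl (Or.inl ⟨i, j, rfl⟩))))
  have h3 : cls (yPlus i j - yPlus j j + yMinus j i) = 0 :=
    cls_eq_zero (Ideal.subset_span (Or.inr ⟨i, j, j, rfl⟩))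
  simp only [cls, map_add, map_sub] at *
  linear_combination h1 - h3

lemma cls_yPlus_eq (i j : X) : cls (yPlus i j) = halfDiag i + halfDiag j := by
  rw [halfDiag, halfDiag, ← smul_add, ← two_smul_cls_yPlus, smul_smul]
  norm_num

lemma cls_y (s : ℤˣ) (i j : X) : cls (y s i j) = halfDiag i + ((s : ℤ) : R X) * halfDiag j := by
  rcases Int.units_eq_one_or s with rfl | rfl
  · simp [y, cls_yPlus_eq]
  · rw [y, if_neg (by decide), cls_yMinus, cls_yPlus_eq, cls_yPlus_eq]
    push_cast
    ring

lemma cls_alpha {g : ℕ} (P : Finset (Sec X g)) : cls (alpha P) = sectionProduct halfDiag P := by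
  rw [alpha, cls, map_prod]
  exact Finset.prod_congr rfl fun σ _ => cls_y _ _ _

lemma cls_mem_pow {N : ℕ} {p : YPoly X} (hp : ∀ m ∈ p.support, N ≤ m.degree) :
    cls p ∈ Ideal.span (Set.range (halfDiag (X := X))) ^ N := by
  have ha : ∀ i : X, halfDiag i ∈ Ideal.span (Set.range (halfDiag (X := X))) :=
    fun i => Ideal.subset_span ⟨i, rfl⟩
  have hvar : ∀ v : YVar X, cls (MvPolynomial.X v) ∈
      Ideal.span (Set.range (halfDiag (X := X))) := by
    have hy : ∀ s (i j : X), cls (y s i j) ∈ Ideal.span (Set.range (halfDiag (X := X))) :=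
      fun s i j => by
        rw [cls_y]
        exact Ideal.add_mem _ (ha _) (Ideal.mul_mem_left _ _ (ha _))
    rintro (⟨i, j⟩ | ⟨i, j, hij⟩)
    · simpa [y, yPlus] using hy 1 i j
    · simpa [y, yMinus, hij] using hy (-1) i j
  rw [cls, p.as_sum, map_sum]
  refine Ideal.sum_mem _ fun m hm => ?_
  rw [MvPolynomial.monomial_eq, map_mul, Finsupp.prod, map_prod]
  refine Ideal.mul_mem_left _ _ (Ideal.pow_le_pow_right (hp m hm) ?_)
  have key : ∏ v ∈ m.support, cls (MvPolynomial.X v) ^ m v ∈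
      ∏ v ∈ m.support, Ideal.span (Set.range (halfDiag (X := X))) ^ m v :=
    Ideal.prod_mem_prod fun v _ => Ideal.pow_mem_pow (hvar v) _
  rw [Finset.prod_pow_eq_pow_sum] at key
  simp only [map_pow, Finsupp.degree_apply]
  exact key

omit [DecidableEq X] in
lemma yPlus_isHomogeneous (i j : X) : (yPlus i j).IsHomogeneous 1 :=
  MvPolynomial.isHomogeneous_X _ _

lemma yMinus_isHomogeneous (i j : X) : (yMinus i j).IsHomogeneous 1 := by
  unfold yMinus
  split_ifs
  · exact MvPolynomial.isHomogeneous_X _ _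
  · exact MvPolynomial.isHomogeneous_zero _ _ _

lemma y_isHomogeneous (s : ℤˣ) (i j : X) : (y s i j).IsHomogeneous 1 := by
  unfold y
  split_ifs
  exacts [yPlus_isHomogeneous i j, yMinus_isHomogeneous i j]

lemma alpha_isHomogeneous {g : ℕ} (P : Finset (Sec X g)) : Homogeneous (alpha P) :=
  ⟨_, MvPolynomial.IsHomogeneous.prod _ _ _ fun _ _ => y_isHomogeneous _ _ _⟩

attribute [local instance] MvPolynomial.gradedAlgebra in
lemma homogeneousComponent_mem_relIdeal {q : YPoly X} (hq : q ∈ relIdeal X) (n : ℕ) :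
    MvPolynomial.homogeneousComponent n q ∈ relIdeal X := by
  refine MvPolynomial.homogeneousComponent_mem_of_mem (Ideal.homogeneous_span _ _ ?_) hq n
  rintro q (((⟨i, j, rfl⟩ | ⟨i, j, rfl⟩) | ⟨i, j, k, rfl⟩) | ⟨i, j, k, rfl⟩) <;> refine ⟨1, ?_⟩ <;>
    rw [MvPolynomial.mem_homogeneousSubmodule]
  · exact (yMinus_isHomogeneous _ _).add (yMinus_isHomogeneous _ _)
  · exact (yPlus_isHomogeneous _ _).sub (yPlus_isHomogeneous _ _)
  · exact ((yMinus_isHomogeneous _ _).add (yMinus_isHomogeneous _ _)).add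
      (yMinus_isHomogeneous _ _)
  · exact ((yPlus_isHomogeneous _ _).sub (yPlus_isHomogeneous _ _)).add (yMinus_isHomogeneous _ _)

/-- As `q` is homogeneous of degree `d`, only the component of `c` of degree `n - d` contributes; if
there is none, `c' = 0`. -/
lemma exists_homogeneousComponent_mul {σ : Type*} (c : MvPolynomial σ ℚ) {q : MvPolynomial σ ℚ}
    {d : ℕ} (hq : q.IsHomogeneous d) (n : ℕ) :
    ∃ c' : MvPolynomial σ ℚ, (∃ k, c'.IsHomogeneous k) ∧
      MvPolynomial.homogeneousComponent n (c * q) = c' * q := by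
  have h1 : ∀ k, MvPolynomial.homogeneousComponent n
      (MvPolynomial.homogeneousComponent k c * q)
      = if n = k + d then MvPolynomial.homogeneousComponent k c * q else 0 := fun k =>
    MvPolynomial.homogeneousComponent_of_mem
      ((MvPolynomial.homogeneousComponent_isHomogeneous k c).mul hq)
  have h2 : MvPolynomial.homogeneousComponent n (c * q)
      = ∑ k ∈ Finset.range (c.totalDegree + 1),
        if n = k + d then MvPolynomial.homogeneousComponent k c * q else 0 := by
    conv_lhs => rw [← MvPolynomial.sum_homogeneousComponent c, Finset.sum_mul, map_sum]
    exact Finset.sum_congr rfl fun k _ => h1 k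
  by_cases hk : ∃ k ∈ Finset.range (c.totalDegree + 1), n = k + d
  · obtain ⟨k, hk, rfl⟩ := hk
    refine ⟨MvPolynomial.homogeneousComponent k c,
      ⟨k, MvPolynomial.homogeneousComponent_isHomogeneous k c⟩, ?_⟩
    rw [h2, Finset.sum_eq_single_of_mem k hk, if_pos rfl]
    intro k' _ hne
    rw [if_neg (by omega)]
  · refine ⟨0, ⟨0, MvPolynomial.isHomogeneous_zero _ _ _⟩, ?_⟩
    rw [h2, zero_mul]
    refine Finset.sum_eq_zero fun k hk' => if_neg fun e => hk ⟨k, hk', e⟩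

/-- The coefficients of a homogeneous combination of homogeneous elements can be chosen
homogeneous. -/
lemma exists_coeff_of_mem_span {ι : Type*} [Fintype ι] {p : YPoly X} {G : ι → YPoly X}
    (hG : ∀ i, Homogeneous (G i)) (hp : cls p ∈ Ideal.span (Set.range fun i => cls (G i))) :
    ∃ c : ι → YPoly X, (Homogeneous p → ∀ i, Homogeneous (c i)) ∧
      cls p = cls (∑ i, c i * G i) := by
  obtain ⟨e, he⟩ := Ideal.mem_span_range_iff_exists_fun.1 hp
  choose c hc using fun i => Ideal.Quotient.mk_surjective (I := relIdeal X) (e i)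
  have hcp : cls p = cls (∑ i, c i * G i) := by
    rw [← he, cls, map_sum]
    exact Finset.sum_congr rfl fun i _ => by rw [map_mul, hc]; rfl
  by_cases hhom : Homogeneous p
  swap
  · exact ⟨c, fun h => absurd h hhom, hcp⟩
  obtain ⟨n, hn⟩ := hhom
  choose d hd using hG
  choose c' hc' hcc' using fun i => exists_homogeneousComponent_mul (c i) (hd i) n
  refine ⟨c', fun _ => hc', ?_⟩
  -- The ideal of relations is homogeneous, so the degree `n` part of the congruence is again a
  -- congruence.
  have h1 := homogeneousComponent_mem_relIdeal (Ideal.Quotient.eq.1 hcp) n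
  rw [map_sub, map_sum, MvPolynomial.homogeneousComponent_eq_self hn] at h1
  simp only [hcc'] at h1
  exact Ideal.Quotient.eq.2 h1

end RingR

/-! ### The decomposition -/

section Decomposition

variable {X : Type*} [Fintype X] [DecidableEq X] {g : ℕ}

lemma cls_block_prod (V : Finset X) :
    cls (∏ ij ∈ block V, (yPlus ij.1 ij.2 * yMinus ij.1 ij.2) ^ (2 * g))
      = cutProduct halfDiag (2 * g) V := by
  rw [cutProduct, ← Finset.prod_product' (f := fun i j =>
    ((halfDiag i + halfDiag j) * (halfDiag i - halfDiag j)) ^ (2 * g)), block, cls, map_prod]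
  refine Finset.prod_congr rfl fun ij _ => ?_
  have h1 := cls_y 1 ij.1 ij.2
  have h2 := cls_y (-1) ij.1 ij.2
  simp only [y, if_true, cls, Units.val_one, Int.cast_one, one_mul] at h1
  rw [y, if_neg (by decide)] at h2
  rw [map_pow, map_mul, h1]
  rw [cls] at h2
  rw [h2]
  push_cast
  ring

lemma alpha_Q (B : Finset (X × X)) (D : Fin (2 * g) → Finset (X × X)) :
    alpha (Q B D) = ∏ m : Fin (2 * g),
      ((∏ ij ∈ D m, yPlus ij.1 ij.2 * yMinus ij.1 ij.2) *
        ∏ ij ∈ Finset.univ.filter (fun ij => ij ∉ D m ∪ bar (D m)),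
          y (-eps B ij.1 ij.2) ij.1 ij.2) := by
  rw [alpha, prod_Q B D y]
  simp [y]

lemma exists_A (g n : ℕ) : ∃ P, A g n P :=
  ⟨_, A.base ∅ (Finset.mem_insert_self _ _) (fun _ => ∅) fun _ => ⟨∅, by simp, by simp⟩⟩

/-- A collection in `𝒜_{|V|}` together with a bijection `{1, …, |V|} → V`. -/
abbrev MarkedCollection (g : ℕ) (V : Finset X) : Type _ :=
  {P : Finset (Sec (Fin V.card) g) // A g V.card P} × (Fin V.card ≃ {i // i ∈ V})

/-- A single `r` must serve all subsets, so the total count is used; repetitions are harmless. -/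
lemma exists_enumeration (g : ℕ) (X : Type*) [Fintype X] [DecidableEq X] :
    ∃ (r : ℕ) (e : ∀ V : Finset X, Fin r → MarkedCollection g V),
      ∀ V, Function.Surjective (e V) := by
  classical
  refine ⟨∑ V : Finset X, Fintype.card (MarkedCollection g V), ?_⟩
  have h : ∀ V : Finset X, ∃ e : Fin (∑ V : Finset X, Fintype.card (MarkedCollection g V)) →
      MarkedCollection g V, Function.Surjective e := by
    intro V
    obtain ⟨P, hP⟩ := exists_A g V.card
    have : Nonempty (MarkedCollection g V) := ⟨⟨P, hP⟩, V.equivFin.symm⟩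
    obtain ⟨f⟩ := Function.Embedding.nonempty_of_card_le (α := MarkedCollection g V)
      (β := Fin (∑ V : Finset X, Fintype.card (MarkedCollection g V))) (by
        rw [Fintype.card_fin]
        exact Finset.single_le_sum (f := fun V : Finset X => Fintype.card (MarkedCollection g V))
          (fun _ _ => Nat.zero_le _) (Finset.mem_univ V))
    exact ⟨_, Function.invFun_surjective f.injective⟩
  choose e he using h
  exact ⟨e, he⟩

/-- For `n = 0` the rational bound is `1`, whereas `powerBound` is `0` by truncated subtraction; for
`n > 0` they agree. -/
lemma powerBound_le_of_rat_le {g n d : ℕ}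
    (h : 2 * (g : ℚ) * (n : ℚ) ^ 2 + 1 / 2 * ((n : ℚ) - 1) * ((n : ℚ) - 2) ≤ (d : ℚ)) :
    powerBound (2 * g) n ≤ d := by
  rcases n with _ | n
  · simp [powerBound]
  have h1 := two_mul_choose_two n
  have h2 : 2 * (n.choose 2 : ℚ) + n = n ^ 2 := by exact_mod_cast h1
  have h3 : ((powerBound (2 * g) (n + 1) : ℕ) : ℚ) ≤ d := by
    refine le_trans (le_of_eq ?_) h
    simp only [powerBound, Nat.add_sub_cancel]
    push_cast
    linear_combination (1 / 2 : ℚ) * h2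
  exact_mod_cast h3

end Decomposition

end GoodMonomials

/-! ### Assembling the decomposition -/

theorem mainTheorem4 {X : Type*} [Fintype X] [DecidableEq X] (g : ℕ) (p : YPoly X)
    (hp : ∀ m ∈ p.support,
      2 * (g : ℚ) * (Fintype.card X : ℚ) ^ 2
        + 1 / 2 * ((Fintype.card X : ℚ) - 1) * ((Fintype.card X : ℚ) - 2) ≤ (m.degree : ℚ)) :
    ∃ (r : ℕ)
      (θ φ : Finset X → Fin r → YPoly X)
      (pV : (V : Finset X) → Fin r → Finset (Sec (Fin V.card) g))
      (pVc : (V : Finset X) → Fin r → Finset (Sec (Fin Vᶜ.card) g))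
      (fV : (V : Finset X) → Fin r → (Fin V.card ≃ {i // i ∈ V}))
      (fVc : (V : Finset X) → Fin r → (Fin Vᶜ.card ≃ {i // i ∈ Vᶜ}))
      (ψ : Finset (X × X) → YPoly X)
      (𝒟 : Finset (X × X) → Finset (Fin (2 * g) → Finset (X × X)))
      (χ : Finset (X × X) → (Fin (2 * g) → Finset (X × X)) → YPoly X),
      (∀ V ∈ properSubsets X, ∀ k, A g V.card (pV V k) ∧ A g Vᶜ.card (pVc V k)) ∧
      (∀ C ∈ insert ∅ (blocks X), ∀ D ∈ 𝒟 C, ∀ m, IsUnionOfBlocks (D m)) ∧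
      (Homogeneous p →
        (∀ V ∈ properSubsets X, ∀ k, Homogeneous (θ V k) ∧ Homogeneous (φ V k)) ∧
        (∀ C ∈ insert ∅ (blocks X), Homogeneous (ψ C) ∧ ∀ D ∈ 𝒟 C, Homogeneous (χ C D))) ∧
      cls p = cls (
        (∑ V ∈ properSubsets X,
          (∏ ij ∈ block V, (yPlus ij.1 ij.2 * yMinus ij.1 ij.2) ^ (2 * g)) *
            ∑ k : Fin r,
              (θ V k * alpha (push (fun i => (fV V k i : X)) (pV V k)) +
               φ V k * alpha (push (fun i => (fVc V k i : X)) (pVc V k)))) +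
        ∑ C ∈ insert ∅ (blocks X),
          ψ C * ∑ D ∈ 𝒟 C,
            χ C D * ∏ m : Fin (2 * g),
              ((∏ ij ∈ D m, yPlus ij.1 ij.2 * yMinus ij.1 ij.2) *
               ∏ ij ∈ Finset.univ.filter (fun ij => ij ∉ D m ∪ bar (D m)),
                 y (-eps C ij.1 ij.2) ij.1 ij.2)) := by
  classical
  obtain ⟨r, e, he⟩ := exists_enumeration g X
  let F : Finset X → YPoly X := fun V =>
    ∏ ij ∈ block V, (yPlus ij.1 ij.2 * yMinus ij.1 ij.2) ^ (2 * g)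
  let G₁ : Finset X → Fin r → YPoly X := fun V k =>
    F V * alpha (push (fun i => ((e V k).2 i : X)) (e V k).1.1)
  let 𝒟 : Finset (Fin (2 * g) → Finset (X × X)) :=
    Finset.univ.filter fun D => ∀ l, IsUnionOfBlocks (D l)
  -- All generators form one finite family, padded by `0` outside the admissible indices.
  let G : (Finset X × Fin r) ⊕ (Finset (X × X) × (Fin (2 * g) → Finset (X × X))) → YPoly X :=
    Sum.elim (fun t => if t.1 ∈ properSubsets X then G₁ t.1 t.2 else 0)
      (fun t => if t.1 ∈ insert ∅ (blocks X) then if t.2 ∈ 𝒟 then alpha (Q t.1 t.2) else 0 else 0)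
  have h0 : Homogeneous (0 : YPoly X) := ⟨0, MvPolynomial.isHomogeneous_zero _ _ _⟩
  have hG : ∀ t, Homogeneous (G t) := by
    rintro (⟨V, k⟩ | ⟨C, D⟩)
    · simp only [G, Sum.elim_inl]
      split_ifs
      · obtain ⟨d, hd⟩ := alpha_isHomogeneous (push (fun i => ((e V k).2 i : X)) (e V k).1.1)
        exact ⟨_, (MvPolynomial.IsHomogeneous.prod _ _ _ fun ij _ =>
          ((yPlus_isHomogeneous _ _).mul (yMinus_isHomogeneous _ _)).pow _).mul hd⟩
      · exact h0
    · simp only [G, Sum.elim_inr]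
      split_ifs
      exacts [alpha_isHomogeneous _, h0, h0]
  have hmem : cls p ∈ Ideal.span (Set.range fun t => cls (G t)) := by
    have hgood : ContainsGoodMonomials (halfDiag (X := X)) (2 * g)
        (Ideal.span (Set.range fun t => cls (G t))) := by
      refine containsGoodMonomials_of (fun B hB D hD => Ideal.subset_span ⟨Sum.inr (B, D), ?_⟩)
        (fun U hU ψ P hP => ?_) fun U _ b => pow_le_span_sectionProduct g _ b
      · have hD' : D ∈ 𝒟 := Finset.mem_filter.2 ⟨Finset.mem_univ _, hD⟩
        simp only [G, Sum.elim_inr, if_pos hB, if_pos hD', cls_alpha]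
      · obtain ⟨k, hk⟩ := he U (⟨P, hP⟩, ψ)
        refine Ideal.subset_span ⟨Sum.inl (U, k), ?_⟩
        have hψ : Function.Injective fun i => (ψ i : X) :=
          Subtype.val_injective.comp ψ.injective
        simp only [G, G₁, F, Sum.elim_inl, if_pos hU, hk]
        rw [← sectionProduct_push hψ, ← cls_alpha, ← cls_block_prod]
        exact map_mul _ _ _
    exact pow_le_of_containsGoodMonomials hgood
      (cls_mem_pow fun m hm => powerBound_le_of_rat_le (hp m hm))
  obtain ⟨c, hc, hcp⟩ := exists_coeff_of_mem_span hG hmem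
  -- Since `Vᶜ` also runs through the proper subsets, the terms `θ` suffice and `φ = 0`; the
  -- coefficients `χ` absorb `ψ`, so `ψ = 1`.
  refine ⟨r, fun V k => c (Sum.inl (V, k)), fun _ _ => 0, fun V k => (e V k).1.1,
    fun V k => (e Vᶜ k).1.1, fun V k => (e V k).2, fun V k => (e Vᶜ k).2, fun _ => 1, fun _ => 𝒟,
    fun C D => c (Sum.inr (C, D)), fun V _ k => ⟨(e V k).1.2, (e Vᶜ k).1.2⟩,
    fun C _ D hD => (Finset.mem_filter.1 hD).2,
    fun hhom => ⟨fun V _ k => ⟨hc hhom _, h0⟩,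
      fun C _ => ⟨⟨0, MvPolynomial.isHomogeneous_one _ _⟩, fun D _ => hc hhom _⟩⟩, ?_⟩
  rw [hcp]
  congr 1
  rw [Fintype.sum_sum_type, Fintype.sum_prod_type, Fintype.sum_prod_type]
  congr 1
  · rw [← Finset.univ_inter (properSubsets X), ← Finset.sum_ite_mem]
    refine Finset.sum_congr rfl fun V _ => ?_
    simp only [G, G₁, F, Sum.elim_inl]
    split_ifs
    · rw [Finset.mul_sum]
      refine Finset.sum_congr rfl fun k _ => ?_
      rw [zero_mul, add_zero, mul_left_comm]
    · simp
  · rw [← Finset.univ_inter (insert ∅ (blocks X)), ← Finset.sum_ite_mem]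
    refine Finset.sum_congr rfl fun C _ => ?_
    simp only [G, Sum.elim_inr, one_mul, ← alpha_Q]
    split_ifs
    · rw [← Finset.univ_inter 𝒟, ← Finset.sum_ite_mem]
      refine Finset.sum_congr rfl fun D _ => ?_
      simp only [mul_ite, mul_zero, Finset.univ_inter]
    · simp
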